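/- Let $\Lambda_\pm:\mathbb R\to\mathbb R$ be bounded $C^2$ functions and consider the Cauchy problem $$\partial_t\lambda_-+\lambda_+\partial_x\lambda_-=0,\qquad \partial_t\lambda_++\lambda_-\partial_x\lambda_+=0,\qquad \lambda_\pm(0,x)=\Lambda_\pm(x).\tag{CP}$$ Define $$t(\alpha,\beta)=\int_\alpha^\beta\frac{d\zeta}{\Lambda_+-\Lambda_-},\qquad x(\alpha,\beta)=\tfrac12\Big\{\alpha+\beta+\int_\alpha^\beta\frac{\Lambda_++\Lambda_-}{\Lambda_+-\Lambda_-}\,d\zeta\Big\},\qquad \Pi(\alpha,\beta)=(t(\alpha,\beta),x(\alpha,\beta)),$$ $\Sigma=\{(\alpha,\beta):\alpha<\beta,\ \Lambda_-(\alpha)=\Lambda_+(\beta)\}$, $\beta(\alpha)=\Lambda_+^{-1}(\Lambda_-(\alpha))$ and $$f(\alpha)=\frac{\Lambda_-'(\alpha)}{\Lambda_+(\beta(\alpha))-\Lambda_-(\beta(\alpha))}-\frac{\Lambda_+'(\beta(\alpha))}{\Lambda_+(\alpha)-\Lambda_-(\alpha)}.$$ Assume: (H1) $\Lambda_-<\Lambda_+$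 on $\mathbb R$; (H2) $\Lambda_-'<0$ and $\Lambda_+'<0$ on $\mathbb R$; and there is $(\alpha_0,\beta_0)\in\Sigma$, that is, $\alpha_0<\beta_0$ and (H3) $\Lambda_-(\alpha_0)=\Lambda_+(\beta_0)$, such that (H4) $f(\alpha_0)=0$ and (H5) $f'(\alpha_0)<0$. Put $(t_0,x_0)=\Pi(\alpha_0,\beta_0)$. The life span (blowup time) of (CP) is the largest $T>0$ for which a $C^1$ solution exists on $[0,T)\times\mathbb R$. Then: 1. $(\alpha_0,\beta_0)$ is a cusp point of $\Pi$: the Jacobian of $\Pi$ vanishes along the curve $\alpha\mapsto(\alpha,\beta(\alpha))$ near $\alpha_0$, and $\alpha\mapsto\Pi(\alpha,\beta(\alpha))$ is $C^2$ near $\alpha_0$ with zero first derivative and nonzero second derivative at $\alpha_0$. Moreover $t(\alpha,\beta(\alpha))>t_0$ for all $\alpha\ne\alpha_0$ near $\alpha_0$. 2. If (CP) has a $C^1$ solution on $[0,T)\times\mathbb R$, then $T\le t_0$. 3. $t_0$ is the blowup time if and only if $(\alpha_0,\beta_0)$ is an earliest point of $\Sigma$, i.e. $t_0\le t(\alpha,\beta)$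 for all $(\alpha,\beta)\in\Sigma$. This holds in particular if $f$ has no zero other than $\alpha_0$ (among the $\alpha$ for which $\beta(\alpha)$ is defined). 4. If $(\alpha_0,\beta_0)$ is an earliest point of $\Sigma$, then (CP) has a $C^1$ solution $(\lambda_-,\lambda_+)$ on $[0,t_0)\times\mathbb R$; every $C^1$ solution of (CP) on a strip $[0,T)\times\mathbb R$ coincides with it there. It blows up at $(t_0,x_0)$: $\lambda_\pm$ are bounded, while $|\partial_x\lambda_-|\to\infty$ and $|\partial_x\lambda_+|\to\infty$ as $(t,x)\to(t_0,x_0)$ with $t<t_0$. The blowup is geometric: $\Pi$ is a bijection of $\{\alpha\le\beta,\ t(\alpha,\beta)<t_0\}$ onto $[0,t_0)\times\mathbb R$ with nonvanishing Jacobian there, and $\lambda_-(\Pi(\alpha,\beta))=\Lambda_-(\alpha)$, $\lambda_+(\Pi(\alpha,\beta))=\Lambda_+(\beta)$ on this set; $\Pi$ maps its cusp point $(\alpha_0,\beta_0)$ to $(t_0,x_0)$; and the two characteristics of different families $\dot\xi_-=\lambda_+(t,\xi_-)$, $\xi_-(0)=\alpha_0$, and $\dot\xi_+=\lambda_-(t,\xi_+)$,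 $\xi_+(0)=\beta_0$, satisfy $\xi_-<\xi_+$ on $[0,t_0)$, both reach $x_0$ at $t=t_0$, and are tangent there, with common (left) slope $\Lambda_-(\alpha_0)=\Lambda_+(\beta_0)$. -/

import Mathlib

open Set Filter Topology

noncomputable section

namespace Chaplygin

/-- The pair `(lm, lp)` is a `C¹` solution on `[0,T) × ℝ` of the Cauchy problem
`∂ₜ lm + lp ∂ₓ lm = 0`, `∂ₜ lp + lm ∂ₓ lp = 0`, `lm(0,·) = Λm`, `lp(0,·) = Λp`.
Functions are written `lm t x`. -/
structure IsClassicalSolution (Λm Λp : ℝ → ℝ) (T : ℝ) (lm lp : ℝ → ℝ → ℝ) : Prop where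
  contDiff_minus : ContDiffOn ℝ 1 (fun p : ℝ × ℝ => lm p.1 p.2) (Ico 0 T ×ˢ univ)
  contDiff_plus : ContDiffOn ℝ 1 (fun p : ℝ × ℝ => lp p.1 p.2) (Ico 0 T ×ˢ univ)
  eq_minus : ∀ t ∈ Ioo 0 T, ∀ x : ℝ,
    deriv (fun s => lm s x) t + lp t x * deriv (fun y => lm t y) x = 0
  eq_plus : ∀ t ∈ Ioo 0 T, ∀ x : ℝ,
    deriv (fun s => lp s x) t + lm t x * deriv (fun y => lp t y) x = 0
  init_minus : ∀ x, lm 0 x = Λm x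
  init_plus : ∀ x, lp 0 x = Λp x

/-- `T` is the life span (blowup time) of the `C¹` solution: the largest `T > 0` such that a
`C¹` solution exists on `[0,T) × ℝ`. -/
def IsLifeSpan (Λm Λp : ℝ → ℝ) (T : ℝ) : Prop :=
  IsGreatest {T : ℝ | 0 < T ∧ ∃ lm lp, IsClassicalSolution Λm Λp T lm lp} T

/-- `ξ` is, on `[0,T)`, the integral curve of the speed `s` starting from `(0,a)`. -/
def IsCharacteristic (s : ℝ → ℝ → ℝ) (T a : ℝ) (ξ : ℝ → ℝ) : Prop :=
  ξ 0 = a ∧ ∀ t ∈ Ico 0 T, HasDerivWithinAt ξ (s t (ξ t)) (Ico 0 T) t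

/-- The set of pairs `α < β` with `Λm α = Λp β`. -/
def singularSet (Λm Λp : ℝ → ℝ) : Set (ℝ × ℝ) :=
  {p | p.1 < p.2 ∧ Λm p.1 = Λp p.2}

/-- `β(α) = Λp⁻¹ (Λm α)`; meaningful where `Λm α` lies in the range of the injective `Λp`. -/
def betaFun (Λm Λp : ℝ → ℝ) (α : ℝ) : ℝ := Function.invFun Λp (Λm α)

/-- The function `f` of the cusp condition. -/
def cuspFun (Λm Λp : ℝ → ℝ) (α : ℝ) : ℝ :=
  deriv Λm α / (Λp (betaFun Λm Λp α) - Λm (betaFun Λm Λp α))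
    - deriv Λp (betaFun Λm Λp α) / (Λp α - Λm α)

/-- Time component of the hodograph map. -/
def hodT (Λm Λp : ℝ → ℝ) (α β : ℝ) : ℝ := ∫ ζ in α..β, 1 / (Λp ζ - Λm ζ)

/-- Space component of the hodograph map. -/
def hodX (Λm Λp : ℝ → ℝ) (α β : ℝ) : ℝ :=
  (α + β + ∫ ζ in α..β, (Λp ζ + Λm ζ) / (Λp ζ - Λm ζ)) / 2

/-- The hodograph map `(α,β) ↦ (t(α,β), x(α,β))`. -/
def hodograph (Λm Λp : ℝ → ℝ) (p : ℝ × ℝ) : ℝ × ℝ :=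
  (hodT Λm Λp p.1 p.2, hodX Λm Λp p.1 p.2)

/-- The Jacobian `t_α x_β - t_β x_α` of the hodograph map. -/
def hodJacobian (Λm Λp : ℝ → ℝ) (α β : ℝ) : ℝ :=
  deriv (fun a => hodT Λm Λp a β) α * deriv (fun b => hodX Λm Λp α b) β
    - deriv (fun b => hodT Λm Λp α b) β * deriv (fun a => hodX Λm Λp a β) α

/-- `(α,β)` is a cusp point of the hodograph map: it is a singular point, lying on the curve
`a ↦ (a, β(a))` of singular points, whose image under the hodograph map has zero first
derivative and nonzero second derivative at `α`. -/
structure IsCuspPoint (Λm Λp : ℝ → ℝ) (α β : ℝ) : Prop where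
  mem_curve : betaFun Λm Λp α = β
  singular : ∀ᶠ a in 𝓝 α, hodJacobian Λm Λp a (betaFun Λm Λp a) = 0
  smooth : ContDiffAt ℝ 2 (fun a => hodograph Λm Λp (a, betaFun Λm Λp a)) α
  deriv_eq : deriv (fun a => hodograph Λm Λp (a, betaFun Λm Λp a)) α = 0
  deriv2_ne : deriv (deriv (fun a => hodograph Λm Λp (a, betaFun Λm Λp a))) α ≠ 0

/-- The solution `(lm, lp)` on `[0,t₀) × ℝ` blows up at `(t₀,x₀)`: it is bounded, and the space
derivatives of both components become infinite as `(t,x) → (t₀,x₀)`, `t < t₀`. -/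
structure BlowsUpAt (lm lp : ℝ → ℝ → ℝ) (t₀ x₀ : ℝ) : Prop where
  bounded : ∃ M : ℝ, ∀ t ∈ Ico 0 t₀, ∀ x, |lm t x| ≤ M ∧ |lp t x| ≤ M
  deriv_minus : Tendsto (fun p : ℝ × ℝ => |deriv (fun y => lm p.1 y) p.2|)
    (𝓝[{p | p.1 < t₀}] (t₀, x₀)) atTop
  deriv_plus : Tendsto (fun p : ℝ × ℝ => |deriv (fun y => lp p.1 y) p.2|)
    (𝓝[{p | p.1 < t₀}] (t₀, x₀)) atTop

/-- The characteristic of speed `lp` from `(0,α)` and the one of speed `lm` from `(0,β)` meet for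
the first time at `(t₀,x₀)`, and they are tangent there, with the common slope `c`. -/
def CharacteristicsTangentAt (lm lp : ℝ → ℝ → ℝ) (α β t₀ x₀ c : ℝ) : Prop :=
  ∃ ξm ξp : ℝ → ℝ,
    IsCharacteristic lp t₀ α ξm ∧ IsCharacteristic lm t₀ β ξp ∧
    (∀ t ∈ Ico 0 t₀, ξm t < ξp t) ∧
    ξm t₀ = x₀ ∧ ξp t₀ = x₀ ∧
    HasDerivWithinAt ξm c (Iic t₀) t₀ ∧ HasDerivWithinAt ξp c (Iic t₀) t₀

/-- Geometric blowup at the image of `(α₀,β₀)`: before time `t₀` the hodograph map is a regular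
change of coordinates in which the solution is `(Λm α, Λp β)`, with no singularity; the blowup
comes from a cusp point of the hodograph map at `(α₀,β₀)`, at which characteristics of the two
different families become tangent. -/
structure IsGeometricBlowup (Λm Λp : ℝ → ℝ) (lm lp : ℝ → ℝ → ℝ) (α₀ β₀ t₀ x₀ : ℝ) : Prop where
  bijOn : BijOn (hodograph Λm Λp) {p | p.1 ≤ p.2 ∧ hodT Λm Λp p.1 p.2 < t₀}
    (Ico 0 t₀ ×ˢ univ)
  regular : ∀ α β, α ≤ β → hodT Λm Λp α β < t₀ → hodJacobian Λm Λp α β ≠ 0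
  solution : ∀ α β, α ≤ β → hodT Λm Λp α β < t₀ →
    lm (hodT Λm Λp α β) (hodX Λm Λp α β) = Λm α ∧
    lp (hodT Λm Λp α β) (hodX Λm Λp α β) = Λp β
  image : hodograph Λm Λp (α₀, β₀) = (t₀, x₀)
  cusp : IsCuspPoint Λm Λp α₀ β₀
  tangent : CharacteristicsTangentAt lm lp α₀ β₀ t₀ x₀ (Λm α₀)

/-- No singular point of the hodograph map has an earlier image time than `(α₀,β₀)`. -/
def IsEarliestSingular (Λm Λp : ℝ → ℝ) (α₀ β₀ : ℝ) : Prop :=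
  ∀ p ∈ singularSet Λm Λp, hodT Λm Λp α₀ β₀ ≤ hodT Λm Λp p.1 p.2

end Chaplygin

end

/-!
The hodograph map separates: with primitives `τ' = 1 / (Λp - Λm)` and `P' = Λp / (Λp - Λm)` one
has `t(α,β) = τ β - τ α` and `x(α,β) = α + P β - P α`, so its Jacobian is
`(Λm α - Λp β) / ((Λp α - Λm α) (Λp β - Λm β))`, which vanishes exactly where `Λm α = Λp β`.

*The cusp.* On the singular curve `α ↦ (α, β(α))` the time has derivative `f / (Λp' ∘ β)`, and the
position has `Λm α` times that derivative. As `f` has a simple zero at `α₀`, decreasing through it,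
the image curve has a cusp there and the time a strict local minimum
(`Admissible.isCuspPoint`, `Admissible.eventually_hodT_lt`), which is global if `f` has no other
zero.

*Upper bound and uniqueness.* Any classical solution is `(Λm α, Λp β)` in hodograph coordinates, by
uniqueness for the linear system that the differences satisfy on triangles `α ≤ a ≤ b ≤ β`
(`eq_zero_of_triangle`, `Admissible.solution_hodograph`). No knowledge of characteristics or of
bounds on the solution is needed. Differentiating this identity at a singular point gives a
contradiction, so no solution outlives a singular point (`Admissible.lifespan_le`).

*Existence.* If `(α₀, β₀)` is an earliest singular point, then `Λm α < Λp β` whenever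
`t(α,β) < t₀`. Hence at each fixed time `t < t₀` the position is a strictly increasing function of
`α`, and a bijection of the line since the data are bounded. The inverse of the hodograph map is
smooth by the inverse function theorem (`Admissible.contDiffAt_hodInv`), and it defines the
solution. Negative times are included, so that the initial line needs no separate treatment.

*Blowup.* The space derivatives of the solution are `Λm' α (Λp α - Λm α) / (Λp β - Λm α)` and
`Λp' β (Λp β - Λm β) / (Λp β - Λm α)`. They are infinite in the limit at the cusp because the
inverse hodograph map is continuous up to `(t₀, x₀)` (`Admissible.tendsto_hodInv`), which uses that
`(α₀, β₀)` is isolated among the singular points of time `t₀`.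
-/

open Set Filter Topology

/-! ### Primitives and the derivatives of the hodograph map -/

namespace Chaplygin

/-- The standing assumptions on the initial data: bounded and `C²`, strictly ordered
(`Λm < Λp`, strict hyperbolicity) and strictly decreasing. -/
structure Admissible (Λm Λp : ℝ → ℝ) : Prop where
  contDiff_minus : ContDiff ℝ 2 Λm
  contDiff_plus : ContDiff ℝ 2 Λp
  bounded : ∃ M : ℝ, ∀ x, |Λm x| ≤ M ∧ |Λp x| ≤ M
  lt : ∀ x, Λm x < Λp x
  deriv_minus_neg : ∀ x, deriv Λm x < 0
  deriv_plus_neg : ∀ x, deriv Λp x < 0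

/-- The primitive `τ` of `1 / (Λp - Λm)`, normalised by `τ 0 = 0`, so that
`t(α,β) = τ β - τ α`. -/
noncomputable def timeCoord (Λm Λp : ℝ → ℝ) (s : ℝ) : ℝ :=
  ∫ ζ in (0 : ℝ)..s, 1 / (Λp ζ - Λm ζ)

/-- The primitive `P` of `Λp / (Λp - Λm)`, normalised by `P 0 = 0`, so that
`x(α,β) = α + P β - P α`. -/
noncomputable def spaceCoord (Λm Λp : ℝ → ℝ) (s : ℝ) : ℝ :=
  ∫ ζ in (0 : ℝ)..s, Λp ζ / (Λp ζ - Λm ζ)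

namespace Admissible

variable {Λm Λp : ℝ → ℝ} (h : Admissible Λm Λp)
include h

lemma gap_pos (s : ℝ) : 0 < Λp s - Λm s := sub_pos.2 (h.lt s)

lemma gap_ne (s : ℝ) : Λp s - Λm s ≠ 0 := (h.gap_pos s).ne'

lemma contDiff_inv_gap : ContDiff ℝ 2 fun s => 1 / (Λp s - Λm s) :=
  contDiff_const.div (h.contDiff_plus.sub h.contDiff_minus) h.gap_ne

lemma contDiff_plus_div_gap : ContDiff ℝ 2 fun s => Λp s / (Λp s - Λm s) :=
  h.contDiff_plus.div (h.contDiff_plus.sub h.contDiff_minus) h.gap_ne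

lemma hasDerivAt_minus (s : ℝ) : HasDerivAt Λm (deriv Λm s) s :=
  (h.contDiff_minus.differentiable (by norm_num) s).hasDerivAt

lemma hasDerivAt_plus (s : ℝ) : HasDerivAt Λp (deriv Λp s) s :=
  (h.contDiff_plus.differentiable (by norm_num) s).hasDerivAt

lemma strictAnti_minus : StrictAnti Λm := strictAnti_of_deriv_neg h.deriv_minus_neg

lemma strictAnti_plus : StrictAnti Λp := strictAnti_of_deriv_neg h.deriv_plus_neg

lemma hasDerivAt_timeCoord (s : ℝ) :
    HasDerivAt (timeCoord Λm Λp) (1 / (Λp s - Λm s)) s :=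
  (h.contDiff_inv_gap.continuous).integral_hasStrictDerivAt 0 s |>.hasDerivAt

lemma hasDerivAt_spaceCoord (s : ℝ) :
    HasDerivAt (spaceCoord Λm Λp) (Λp s / (Λp s - Λm s)) s :=
  (h.contDiff_plus_div_gap.continuous).integral_hasStrictDerivAt 0 s |>.hasDerivAt

lemma contDiff_timeCoord : ContDiff ℝ 2 (timeCoord Λm Λp) := by
  rw [show (2 : WithTop ℕ∞) = 1 + 1 by norm_num, contDiff_succ_iff_deriv]
  refine ⟨fun s => (h.hasDerivAt_timeCoord s).differentiableAt, by simp, ?_⟩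
  rw [funext fun s => (h.hasDerivAt_timeCoord s).deriv]
  exact h.contDiff_inv_gap.of_le (by norm_num)

lemma contDiff_spaceCoord : ContDiff ℝ 2 (spaceCoord Λm Λp) := by
  rw [show (2 : WithTop ℕ∞) = 1 + 1 by norm_num, contDiff_succ_iff_deriv]
  refine ⟨fun s => (h.hasDerivAt_spaceCoord s).differentiableAt, by simp, ?_⟩
  rw [funext fun s => (h.hasDerivAt_spaceCoord s).deriv]
  exact h.contDiff_plus_div_gap.of_le (by norm_num)

lemma strictMono_timeCoord : StrictMono (timeCoord Λm Λp) :=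
  strictMono_of_deriv_pos fun s => by
    rw [(h.hasDerivAt_timeCoord s).deriv]; exact one_div_pos.2 (h.gap_pos s)

lemma hodT_eq (α β : ℝ) :
    hodT Λm Λp α β = timeCoord Λm Λp β - timeCoord Λm Λp α :=
  (intervalIntegral.integral_interval_sub_left
    (h.contDiff_inv_gap.continuous.intervalIntegrable _ _)
    (h.contDiff_inv_gap.continuous.intervalIntegrable _ _)).symm

lemma hodX_eq (α β : ℝ) :
    hodX Λm Λp α β = α + spaceCoord Λm Λp β - spaceCoord Λm Λp α := by
  have hint : ∀ a b, IntervalIntegrable (fun s => Λp s / (Λp s - Λm s)) MeasureTheory.volume a b :=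
    fun a b => h.contDiff_plus_div_gap.continuous.intervalIntegrable a b
  have h1 : spaceCoord Λm Λp β - spaceCoord Λm Λp α = ∫ ζ in α..β, Λp ζ / (Λp ζ - Λm ζ) :=
    intervalIntegral.integral_interval_sub_left (hint _ _) (hint _ _)
  have h2 : (fun ζ => (Λp ζ + Λm ζ) / (Λp ζ - Λm ζ))
      = fun ζ => 2 * (Λp ζ / (Λp ζ - Λm ζ)) - 1 := by
    funext ζ
    have := h.gap_ne ζ
    field_simp
    ring
  rw [hodX, h2, intervalIntegral.integral_sub ((hint _ _).const_mul 2) intervalIntegrable_const,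
    intervalIntegral.integral_const_mul, ← h1, intervalIntegral.integral_const]
  simp only [smul_eq_mul, mul_one]
  ring

lemma hasDerivAt_hodT_right (α β : ℝ) :
    HasDerivAt (fun b => hodT Λm Λp α b) (1 / (Λp β - Λm β)) β := by
  simp only [h.hodT_eq]
  exact (h.hasDerivAt_timeCoord β).sub_const _

lemma hasDerivAt_hodT_left (α β : ℝ) :
    HasDerivAt (fun a => hodT Λm Λp a β) (-(1 / (Λp α - Λm α))) α := by
  simp only [h.hodT_eq]
  exact (h.hasDerivAt_timeCoord α).const_sub _

lemma hasDerivAt_hodX_right (α β : ℝ) :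
    HasDerivAt (fun b => hodX Λm Λp α b) (Λp β / (Λp β - Λm β)) β := by
  simp only [h.hodX_eq]
  exact ((h.hasDerivAt_spaceCoord β).const_add _).sub_const _

lemma hasDerivAt_hodX_left (α β : ℝ) :
    HasDerivAt (fun a => hodX Λm Λp a β) (-(Λm α / (Λp α - Λm α))) α := by
  simp only [h.hodX_eq]
  have := ((hasDerivAt_id α).add_const (spaceCoord Λm Λp β)).sub (h.hasDerivAt_spaceCoord α)
  refine this.congr_deriv ?_
  have := h.gap_ne α
  field_simp
  ring

lemma hodJacobian_eq (α β : ℝ) :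
    hodJacobian Λm Λp α β
      = (Λm α - Λp β) / ((Λp α - Λm α) * (Λp β - Λm β)) := by
  rw [hodJacobian, (h.hasDerivAt_hodT_left α β).deriv, (h.hasDerivAt_hodT_right α β).deriv,
    (h.hasDerivAt_hodX_left α β).deriv, (h.hasDerivAt_hodX_right α β).deriv]
  have := h.gap_ne α
  have := h.gap_ne β
  field_simp
  ring

lemma contDiff_hodograph : ContDiff ℝ 2 (hodograph Λm Λp) := by
  have h1 := h.contDiff_timeCoord
  have h2 := h.contDiff_spaceCoord
  unfold hodograph
  simp only [h.hodT_eq, h.hodX_eq]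
  fun_prop

lemma exists_bound : ∃ M : ℝ, 0 < M ∧ ∀ x, |Λm x| ≤ M ∧ |Λp x| ≤ M := by
  obtain ⟨M, hM⟩ := h.bounded
  exact ⟨|M| + 1, by positivity, fun x =>
    ⟨(hM x).1.trans (by linarith [le_abs_self M]), (hM x).2.trans (by linarith [le_abs_self M])⟩⟩

/-- Boundedness of the data makes the time coordinate a global coordinate on the line. -/
lemma surjective_timeCoord : Function.Surjective (timeCoord Λm Λp) := by
  obtain ⟨M, hM0, hM⟩ := h.exists_bound
  have hmono : Monotone fun s => timeCoord Λm Λp s - s / (2 * M) := by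
    have hd : ∀ s, HasDerivAt (fun s => timeCoord Λm Λp s - s / (2 * M))
        (1 / (Λp s - Λm s) - 1 / (2 * M)) s :=
      fun s => (h.hasDerivAt_timeCoord s).sub ((hasDerivAt_id s).div_const _)
    refine monotone_of_deriv_nonneg (fun s => (hd s).differentiableAt) fun s => ?_
    rw [(hd s).deriv, sub_nonneg]
    refine one_div_le_one_div_of_le (h.gap_pos s) ?_
    linarith [abs_le.1 (hM s).1, abs_le.1 (hM s).2]
  have h0 : timeCoord Λm Λp 0 = 0 := by simp [timeCoord]
  refine h.contDiff_timeCoord.continuous.surjective ?_ ?_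
  · refine tendsto_atTop_mono' _ ?_ (tendsto_id.atTop_div_const (by positivity : 0 < 2 * M))
    filter_upwards [eventually_ge_atTop 0] with s hs
    have := hmono hs
    simp only [h0, zero_div, sub_zero, id] at this ⊢
    linarith
  · refine tendsto_atBot_mono' _ ?_ (tendsto_id.atBot_div_const (by positivity : 0 < 2 * M))
    filter_upwards [eventually_le_atBot 0] with s hs
    have := hmono hs
    simp only [h0, zero_div, sub_zero, id] at this ⊢
    linarith

end Admissible

end Chaplygin

/-! ### The singular curve and its cusp -/

namespace Chaplygin

lemma plus_betaFun {Λm Λp : ℝ → ℝ} {α : ℝ} (hα : Λm α ∈ range Λp) :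
    Λp (betaFun Λm Λp α) = Λm α :=
  Function.invFun_eq hα

namespace Admissible

variable {Λm Λp : ℝ → ℝ} (h : Admissible Λm Λp)
include h

lemma betaFun_eq {α β : ℝ} (hab : Λm α = Λp β) : betaFun Λm Λp α = β := by
  rw [betaFun, hab]
  exact Function.leftInverse_invFun h.strictAnti_plus.injective β

lemma lt_of_minus_eq_plus {α β : ℝ} (hab : Λm α = Λp β) : α < β :=
  h.strictAnti_plus.lt_iff_gt.1 (hab ▸ h.lt α)

lemma mem_singularSet_betaFun {α : ℝ} (hα : Λm α ∈ range Λp) :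
    (α, betaFun Λm Λp α) ∈ singularSet Λm Λp :=
  ⟨h.lt_of_minus_eq_plus (plus_betaFun hα).symm, (plus_betaFun hα).symm⟩

/-- Where `Λp⁻¹ (Λm α)` makes sense, it makes sense nearby and is `C²`: `Function.invFun Λp`
agrees with the local inverse given by the inverse function theorem, by injectivity of `Λp`. -/
lemma betaFun_regular {α : ℝ} (hα : Λm α ∈ range Λp) :
    ContDiffAt ℝ 2 (betaFun Λm Λp) α ∧ ∀ᶠ a in 𝓝 α, Λm a ∈ range Λp := by
  obtain ⟨β, hβ⟩ := hα
  have hne : deriv Λp β ≠ 0 := (h.deriv_plus_neg β).ne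
  have hcd : ContDiffAt ℝ 2 Λp β := h.contDiff_plus.contDiffAt
  have hder : HasFDerivAt Λp
      ((ContinuousLinearEquiv.unitsEquivAut ℝ (Units.mk0 _ hne) : ℝ ≃L[ℝ] ℝ) : ℝ →L[ℝ] ℝ) β :=
    (h.hasDerivAt_plus β).hasFDerivAt_equiv hne
  have hn : (2 : WithTop ℕ∞) ≠ 0 := by norm_num
  have hg := hcd.to_localInverse hder hn
  have hright : ∀ᶠ y in 𝓝 (Λp β), Λp (hcd.localInverse hder hn y) = y :=
    (hcd.hasStrictFDerivAt' hder hn).eventually_right_inverse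
  rw [hβ] at hright hg
  have hcont : Tendsto Λm (𝓝 α) (𝓝 (Λm α)) := h.contDiff_minus.continuous.tendsto α
  have hev := hcont.eventually hright
  refine ⟨?_, hev.mono fun a ha => ⟨_, ha⟩⟩
  refine (hg.comp α h.contDiff_minus.contDiffAt).congr_of_eventuallyEq ?_
  filter_upwards [hev] with a ha
  exact h.betaFun_eq ha.symm

lemma hasDerivAt_betaFun {α : ℝ} (hα : Λm α ∈ range Λp) :
    HasDerivAt (betaFun Λm Λp) (deriv Λm α / deriv Λp (betaFun Λm Λp α)) α := by
  obtain ⟨h1, h2⟩ := h.betaFun_regular hα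
  have h3 := (h1.differentiableAt (by norm_num)).hasDerivAt
  have h4 := (h.hasDerivAt_plus _).comp α h3
  have h5 : HasDerivAt (Λp ∘ betaFun Λm Λp) (deriv Λm α) α :=
    (h.hasDerivAt_minus α).congr_of_eventuallyEq (h2.mono fun a ha => plus_betaFun ha)
  have hne : deriv Λp (betaFun Λm Λp α) ≠ 0 := (h.deriv_plus_neg _).ne
  refine h3.congr_deriv ?_
  rw [eq_div_iff hne, mul_comm]
  exact h4.unique h5

/-- Along the singular curve the time has derivative `f / (Λp' ∘ β)`, hence monotonicity opposite
to the sign of `f`. -/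
lemma hasDerivAt_hodT_betaFun {α : ℝ} (hα : Λm α ∈ range Λp) :
    HasDerivAt (fun a => hodT Λm Λp a (betaFun Λm Λp a))
      (cuspFun Λm Λp α / deriv Λp (betaFun Λm Λp α)) α := by
  simp only [h.hodT_eq]
  refine (((h.hasDerivAt_timeCoord _).comp α (h.hasDerivAt_betaFun hα)).sub
    (h.hasDerivAt_timeCoord α)).congr_deriv ?_
  have h1 := (h.deriv_plus_neg (betaFun Λm Λp α)).ne
  have h2 := h.gap_ne α
  have h3 := h.gap_ne (betaFun Λm Λp α)
  rw [cuspFun]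
  field_simp

/-- The image of the singular curve moves with the common characteristic speed `Λm α`. -/
lemma hasDerivAt_hodX_betaFun {α : ℝ} (hα : Λm α ∈ range Λp) :
    HasDerivAt (fun a => hodX Λm Λp a (betaFun Λm Λp a))
      (Λm α * (cuspFun Λm Λp α / deriv Λp (betaFun Λm Λp α))) α := by
  simp only [h.hodX_eq]
  refine (((hasDerivAt_id α).add ((h.hasDerivAt_spaceCoord _).comp α
    (h.hasDerivAt_betaFun hα))).sub (h.hasDerivAt_spaceCoord α)).congr_deriv ?_
  have h1 := (h.deriv_plus_neg (betaFun Λm Λp α)).ne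
  have h2 := h.gap_ne α
  have h3 := h.gap_ne (betaFun Λm Λp α)
  rw [cuspFun]
  rw [plus_betaFun hα] at h3 ⊢
  field_simp
  ring

lemma continuousAt_cuspFun {α : ℝ} (hα : Λm α ∈ range Λp) :
    ContinuousAt (cuspFun Λm Λp) α := by
  have hβ : ContinuousAt (betaFun Λm Λp) α := (h.hasDerivAt_betaFun hα).continuousAt
  have hm := h.contDiff_minus.continuous
  have hp := h.contDiff_plus.continuous
  have hdm := h.contDiff_minus.continuous_deriv (by norm_num)
  have hdp := h.contDiff_plus.continuous_deriv (by norm_num)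
  refine ContinuousAt.sub (ContinuousAt.div hdm.continuousAt ?_ (h.gap_ne _))
    (ContinuousAt.div (hdp.continuousAt.comp hβ) ?_ (h.gap_ne _))
  · exact (hp.continuousAt.comp hβ).sub (hm.continuousAt.comp hβ)
  · exact hp.continuousAt.sub hm.continuousAt

lemma minus_mem_range_of_mem_Icc {a b c : ℝ} (ha : Λm a ∈ range Λp) (hb : Λm b ∈ range Λp)
    (hc : c ∈ Icc a b) : Λm c ∈ range Λp := by
  obtain ⟨u, hu⟩ := ha
  obtain ⟨v, hv⟩ := hb
  refine mem_range_of_exists_le_of_exists_ge h.contDiff_plus.continuous ⟨v, ?_⟩ ⟨u, ?_⟩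
  · rw [hv]; exact h.strictAnti_minus.antitone hc.2
  · rw [hu]; exact h.strictAnti_minus.antitone hc.1

lemma continuousOn_hodT_betaFun {s : Set ℝ} (hs : ∀ a ∈ s, Λm a ∈ range Λp) :
    ContinuousOn (fun a => hodT Λm Λp a (betaFun Λm Λp a)) s :=
  fun a ha => (h.hasDerivAt_hodT_betaFun (hs a ha)).continuousAt.continuousWithinAt

lemma hodT_betaFun_lt_of_pos {a b : ℝ} (hab : a < b) (ha : Λm a ∈ range Λp)
    (hb : Λm b ∈ range Λp) (hf : ∀ c ∈ Ioo a b, 0 < cuspFun Λm Λp c) :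
    hodT Λm Λp b (betaFun Λm Λp b) < hodT Λm Λp a (betaFun Λm Λp a) := by
  refine strictAntiOn_of_deriv_neg (convex_Icc a b)
    (h.continuousOn_hodT_betaFun fun c hc => h.minus_mem_range_of_mem_Icc ha hb hc) (fun c hc => ?_)
    (left_mem_Icc.2 hab.le) (right_mem_Icc.2 hab.le) hab
  rw [interior_Icc] at hc
  rw [(h.hasDerivAt_hodT_betaFun
    (h.minus_mem_range_of_mem_Icc ha hb (Ioo_subset_Icc_self hc))).deriv]
  exact div_neg_of_pos_of_neg (hf c hc) (h.deriv_plus_neg _)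

lemma hodT_betaFun_lt_of_neg {a b : ℝ} (hab : a < b) (ha : Λm a ∈ range Λp)
    (hb : Λm b ∈ range Λp) (hf : ∀ c ∈ Ioo a b, cuspFun Λm Λp c < 0) :
    hodT Λm Λp a (betaFun Λm Λp a) < hodT Λm Λp b (betaFun Λm Λp b) := by
  refine strictMonoOn_of_deriv_pos (convex_Icc a b)
    (h.continuousOn_hodT_betaFun fun c hc => h.minus_mem_range_of_mem_Icc ha hb hc) (fun c hc => ?_)
    (left_mem_Icc.2 hab.le) (right_mem_Icc.2 hab.le) hab
  rw [interior_Icc] at hc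
  rw [(h.hasDerivAt_hodT_betaFun
    (h.minus_mem_range_of_mem_Icc ha hb (Ioo_subset_Icc_self hc))).deriv]
  exact div_pos_of_neg_of_neg (hf c hc) (h.deriv_plus_neg _)

section Cusp

variable {α₀ β₀ : ℝ} (H3 : (α₀, β₀) ∈ singularSet Λm Λp) (H4 : cuspFun Λm Λp α₀ = 0)
  (H5 : deriv (cuspFun Λm Λp) α₀ < 0)
include H3 H4 H5

lemma exists_cuspFun_sign : ∃ ε > 0,
    (∀ a ∈ Ioo (α₀ - ε) α₀, 0 < cuspFun Λm Λp a) ∧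
    (∀ a ∈ Ioo α₀ (α₀ + ε), cuspFun Λm Λp a < 0) ∧
    ∀ a ∈ Ioo (α₀ - ε) (α₀ + ε), Λm a ∈ range Λp := by
  have h1 := eventually_nhdsWithin_sign_eq_of_deriv_neg H5 H4
  obtain ⟨ε, hε, hball⟩ :=
    Metric.eventually_nhds_iff_ball.1 (h1.and (h.betaFun_regular ⟨β₀, H3.2.symm⟩).2)
  simp only [Real.ball_eq_Ioo] at hball
  refine ⟨ε, hε, fun a ha => ?_, fun a ha => ?_, fun a ha => (hball a ha).2⟩
  · have := (hball a ⟨ha.1, by linarith [ha.2]⟩).1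
    rwa [sign_pos (sub_pos.2 ha.2), sign_eq_one_iff] at this
  · have := (hball a ⟨by linarith [ha.1], ha.2⟩).1
    rwa [sign_neg (sub_neg.2 ha.1), sign_eq_neg_one_iff] at this

/-- The cusp is a strict local minimum of the time on the singular curve, since there `f` changes
sign from positive to negative. -/
lemma eventually_hodT_lt :
    ∀ᶠ a in 𝓝[≠] α₀, hodT Λm Λp α₀ β₀ < hodT Λm Λp a (betaFun Λm Λp a) := by
  obtain ⟨ε, hε, hl, hr, hA⟩ := h.exists_cuspFun_sign H3 H4 H5
  rw [eventually_nhdsWithin_iff]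
  filter_upwards [Ioo_mem_nhds (show α₀ - ε < α₀ by linarith) (show α₀ < α₀ + ε by linarith)]
    with a ha hne
  have h0 : Λm α₀ ∈ range Λp := ⟨β₀, H3.2.symm⟩
  have e : hodT Λm Λp α₀ β₀ = hodT Λm Λp α₀ (betaFun Λm Λp α₀) := by rw [h.betaFun_eq H3.2]
  rw [e]
  rcases lt_or_gt_of_ne (show a ≠ α₀ from hne) with hlt | hgt
  · exact h.hodT_betaFun_lt_of_pos hlt (hA a ha) h0 fun c hc => hl c ⟨ha.1.trans hc.1, hc.2⟩
  · exact h.hodT_betaFun_lt_of_neg hgt h0 (hA a ha) fun c hc => hr c ⟨hc.1, hc.2.trans ha.2⟩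

/-- Without further zeros, `f` is positive to the left of `α₀` and negative to the right of it on
the whole interval of definition of `β`, which makes the local minimum of the time global. -/
lemma isEarliestSingular_of_unique_zero
    (huniq : ∀ p ∈ singularSet Λm Λp, cuspFun Λm Λp p.1 = 0 → p.1 = α₀) :
    IsEarliestSingular Λm Λp α₀ β₀ := by
  obtain ⟨ε, hε, hl, hr, hA⟩ := h.exists_cuspFun_sign H3 H4 H5
  have h0 : Λm α₀ ∈ range Λp := ⟨β₀, H3.2.symm⟩
  have hz : ∀ c, Λm c ∈ range Λp → cuspFun Λm Λp c = 0 → c = α₀ := fun c hc hfc =>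
    huniq _ (h.mem_singularSet_betaFun hc) hfc
  rintro ⟨a, b⟩ hab
  have ha : Λm a ∈ range Λp := ⟨b, hab.2.symm⟩
  have e0 := h.betaFun_eq H3.2
  have e1 := h.betaFun_eq hab.2
  simp only at e0 e1 ⊢
  rw [← e0, ← e1]
  rcases lt_trichotomy a α₀ with hlt | rfl | hgt
  · refine (h.hodT_betaFun_lt_of_pos hlt ha h0 fun c hc => ?_).le
    by_contra! hneg
    -- close to `α₀` there is `d > c` with `f d > 0`, which would give a zero of `f` in `[c, d]`
    obtain ⟨d, hd1, hd2⟩ := exists_between (max_lt hc.2 (show α₀ - ε < α₀ by linarith))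
    have hcd : c < d := (le_max_left _ _).trans_lt hd1
    have hA' : ∀ x ∈ Icc c d, Λm x ∈ range Λp := fun x hx =>
      h.minus_mem_range_of_mem_Icc ha h0 ⟨hc.1.le.trans hx.1, hx.2.trans hd2.le⟩
    obtain ⟨z, hz1, hz2⟩ := intermediate_value_Icc hcd.le
      (fun x hx => (h.continuousAt_cuspFun (hA' x hx)).continuousWithinAt)
      (show (0 : ℝ) ∈ Icc _ _ from ⟨hneg, (hl d ⟨(le_max_right _ _).trans_lt hd1, hd2⟩).le⟩)
    linarith [hz z (hA' z hz1) hz2, hz1.2]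
  · exact le_rfl
  · refine (h.hodT_betaFun_lt_of_neg hgt h0 ha fun c hc => ?_).le
    by_contra! hpos
    obtain ⟨d, hd1, hd2⟩ := exists_between (lt_min hc.1 (show α₀ < α₀ + ε by linarith))
    have hdc : d < c := hd2.trans_le (min_le_left _ _)
    have hA' : ∀ x ∈ Icc d c, Λm x ∈ range Λp := fun x hx =>
      h.minus_mem_range_of_mem_Icc h0 ha ⟨hd1.le.trans hx.1, hx.2.trans hc.2.le⟩
    obtain ⟨z, hz1, hz2⟩ := intermediate_value_Icc hdc.le
      (fun x hx => (h.continuousAt_cuspFun (hA' x hx)).continuousWithinAt)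
      (show (0 : ℝ) ∈ Icc _ _ from ⟨(hr d ⟨hd1, hd2.trans_le (min_le_right _ _)⟩).le, hpos⟩)
    linarith [hz z (hA' z hz1) hz2, hz1.1]

lemma isCuspPoint : IsCuspPoint Λm Λp α₀ β₀ := by
  have h0 : Λm α₀ ∈ range Λp := ⟨β₀, H3.2.symm⟩
  obtain ⟨hcd, hev⟩ := h.betaFun_regular h0
  have hder : ∀ a, Λm a ∈ range Λp →
      HasDerivAt (fun a => hodograph Λm Λp (a, betaFun Λm Λp a))
        (cuspFun Λm Λp a / deriv Λp (betaFun Λm Λp a),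
          Λm a * (cuspFun Λm Λp a / deriv Λp (betaFun Λm Λp a))) a := fun a ha =>
    (h.hasDerivAt_hodT_betaFun ha).prodMk (h.hasDerivAt_hodX_betaFun ha)
  have hβ0 : betaFun Λm Λp α₀ = β₀ := h.betaFun_eq H3.2
  refine ⟨hβ0, hev.mono fun a ha => ?_, ?_, ?_, fun hzero => ?_⟩
  · rw [h.hodJacobian_eq, plus_betaFun ha, sub_self, zero_div]
  · exact h.contDiff_hodograph.contDiffAt.comp α₀ (contDiffAt_id.prodMk hcd)
  · rw [(hder _ h0).deriv, H4]
    simp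
  · -- the first component of the second derivative is `f'(α₀) / Λp'(β₀)`, because `f(α₀) = 0`
    have hnum : HasDerivAt (cuspFun Λm Λp) (deriv (cuspFun Λm Λp) α₀) α₀ :=
      (differentiableAt_of_deriv_ne_zero H5.ne).hasDerivAt
    have hdp : Differentiable ℝ (deriv Λp) :=
      (contDiff_succ_iff_deriv (n := 1) |>.1
        (by simpa [one_add_one_eq_two] using h.contDiff_plus)).2.2.differentiable (by norm_num)
    have hden : DifferentiableAt ℝ (fun a => deriv Λp (betaFun Λm Λp a)) α₀ :=
      (hdp _).comp α₀ (hcd.differentiableAt (by norm_num))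
    have hne : deriv Λp (betaFun Λm Λp α₀) ≠ 0 := (h.deriv_plus_neg _).ne
    have hslope := hnum.div hden.hasDerivAt hne
    have hpair := hslope.prodMk ((h.hasDerivAt_minus α₀).mul hslope)
    have h2 := hpair.congr_of_eventuallyEq
      (f₁ := deriv fun a => hodograph Λm Λp (a, betaFun Λm Λp a))
      (hev.mono fun a ha => (hder a ha).deriv)
    have h3 := congrArg Prod.fst (h2.deriv.symm.trans hzero)
    simp only [H4, zero_mul, sub_zero, Prod.fst_zero, div_eq_zero_iff, mul_eq_zero, hne, H5.ne,
      or_false, pow_eq_zero_iff, ne_eq, OfNat.ofNat_ne_zero, not_false_eq_true] at h3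

end Cusp

end Admissible
end Chaplygin

/-! ### Classical solutions in hodograph coordinates -/

namespace Chaplygin

lemma abs_le_of_abs_deriv_le {u u' B B' : ℝ → ℝ} {a b : ℝ} (hab : a ≤ b)
    (hu : ContinuousOn u (Icc a b)) (hu' : ∀ s ∈ Ioo a b, HasDerivAt u (u' s) s)
    (hB : ∀ s, HasDerivAt B (B' s) s) (hle : ∀ s ∈ Ioo a b, |u' s| ≤ B' s)
    (hua : u a = 0) (hBa : 0 ≤ B a) : |u b| ≤ B b := by
  have hBc : ContinuousOn B (Icc a b) := fun s _ => (hB s).continuousAt.continuousWithinAt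
  have h1 : MonotoneOn (B - u) (Icc a b) := by
    refine monotoneOn_of_hasDerivWithinAt_nonneg (convex_Icc a b) (hBc.sub hu) (f' := B' - u')
      (fun s hs => ?_) fun s hs => ?_
    · rw [interior_Icc] at hs ⊢
      exact ((hB s).sub (hu' s hs)).hasDerivWithinAt
    · rw [interior_Icc] at hs
      exact sub_nonneg.2 (abs_le.1 (hle s hs)).2
  have h2 : MonotoneOn (B + u) (Icc a b) := by
    refine monotoneOn_of_hasDerivWithinAt_nonneg (convex_Icc a b) (hBc.add hu) (f' := B' + u')
      (fun s hs => ?_) fun s hs => ?_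
    · rw [interior_Icc] at hs ⊢
      exact ((hB s).add (hu' s hs)).hasDerivWithinAt
    · rw [interior_Icc] at hs
      have := (abs_le.1 (hle s hs)).1
      simp only [Pi.add_apply]
      linarith
  have h3 := h1 (left_mem_Icc.2 hab) (right_mem_Icc.2 hab) hab
  have h4 := h2 (left_mem_Icc.2 hab) (right_mem_Icc.2 hab) hab
  simp only [Pi.sub_apply, Pi.add_apply, hua] at h3 h4
  rw [abs_le]
  constructor <;> linarith

lemma isCompact_triangle (α β : ℝ) :
    IsCompact {p : ℝ × ℝ | α ≤ p.1 ∧ p.1 ≤ p.2 ∧ p.2 ≤ β} := by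
  refine ((isCompact_Icc (a := α) (b := β)).prod
    (isCompact_Icc (a := α) (b := β))).of_isClosed_subset ?_ ?_
  · exact ((isClosed_le continuous_const continuous_fst).inter
      ((isClosed_le continuous_fst continuous_snd).inter
        (isClosed_le continuous_snd continuous_const)))
  · rintro ⟨x, y⟩ ⟨h1, h2, h3⟩
    exact ⟨⟨h1, h2.trans h3⟩, ⟨h1.trans h2, h3⟩⟩

/-- Uniqueness for a linear system in characteristic form, `∂_b U = O(V)`, `∂_a V = O(U)`, on the
triangle `α ≤ a ≤ b ≤ β`, with zero data on the diagonal. -/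
lemma eq_zero_of_triangle {α β C : ℝ} (U V : ℝ × ℝ → ℝ)
    (hU : ContinuousOn U {p | α ≤ p.1 ∧ p.1 ≤ p.2 ∧ p.2 ≤ β})
    (hV : ContinuousOn V {p | α ≤ p.1 ∧ p.1 ≤ p.2 ∧ p.2 ≤ β})
    (hU' : ∀ a b, α ≤ a → a < b → b ≤ β →
      ∃ u', HasDerivAt (fun s => U (a, s)) u' b ∧ |u'| ≤ C * |V (a, b)|)
    (hV' : ∀ a b, α ≤ a → a < b → b ≤ β →
      ∃ v', HasDerivAt (fun s => V (s, b)) v' a ∧ |v'| ≤ C * |U (a, b)|)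
    (hU0 : ∀ a, U (a, a) = 0) (hV0 : ∀ a, V (a, a) = 0)
    {a b : ℝ} (ha : α ≤ a) (hab : a ≤ b) (hb : b ≤ β) : U (a, b) = 0 ∧ V (a, b) = 0 := by
  set D : Set (ℝ × ℝ) := {p | α ≤ p.1 ∧ p.1 ≤ p.2 ∧ p.2 ≤ β}
  have hDc : IsCompact D := isCompact_triangle α β
  -- `W` is the maximum of `max |U| |V| * exp (-k (b - a))`; as `k ≥ 2 C`, integrating the
  -- equations from the diagonal shows `W ≤ W / 2`
  set k : ℝ := 2 * (|C| + 1) with hk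
  have hk0 : 0 < k := by positivity
  have hCk : C ≤ k / 2 := by rw [hk]; linarith [le_abs_self C]
  set G : ℝ × ℝ → ℝ := fun p => max |U p| |V p| * Real.exp (-(k * (p.2 - p.1))) with hG
  have hGc : ContinuousOn G D := by
    refine (hU.abs.sup hV.abs).mul (Continuous.continuousOn ?_)
    fun_prop
  obtain ⟨q, hqD, hq⟩ := hDc.exists_isMaxOn ⟨(a, b), ha, hab, hb⟩ hGc
  set W := G q with hW
  have hW0 : 0 ≤ W := by rw [hW, hG]; positivity
  have hmax : ∀ p ∈ D, max |U p| |V p| ≤ W * Real.exp (k * (p.2 - p.1)) := fun p hp => by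
    have : G p ≤ W := hq hp
    simp only [hG] at this
    rwa [Real.exp_neg, ← div_eq_mul_inv, div_le_iff₀ (Real.exp_pos _)] at this
  have hCW : ∀ p ∈ D, ∀ y, |y| ≤ max |U p| |V p| →
      C * |y| ≤ W / 2 * (Real.exp (k * (p.2 - p.1)) * k) := fun p hp y hy => by
    calc C * |y| ≤ k / 2 * |y| := by gcongr
      _ ≤ k / 2 * (W * Real.exp (k * (p.2 - p.1))) := by
        gcongr
        exact hy.trans (hmax p hp)
      _ = _ := by ring
  have hUle : ∀ p ∈ D, |U p| ≤ W / 2 * Real.exp (k * (p.2 - p.1)) := by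
    rintro ⟨x, y⟩ ⟨h1, h2, h3⟩
    simp only at h1 h2 h3
    have hex : ∀ s, ∃ u', s ∈ Ioo x y → HasDerivAt (fun s => U (x, s)) u' s ∧
        |u'| ≤ C * |V (x, s)| := fun s => by
      by_cases hs : s ∈ Ioo x y
      · obtain ⟨u', hu⟩ := hU' x s h1 hs.1 (hs.2.le.trans h3)
        exact ⟨u', fun _ => hu⟩
      · exact ⟨0, fun h => absurd h hs⟩
    choose u' hu' using hex
    refine abs_le_of_abs_deriv_le (u := fun s => U (x, s)) (u' := u')
      (B := fun s => W / 2 * Real.exp (k * (s - x)))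
      (B' := fun s => W / 2 * (Real.exp (k * (s - x)) * k)) h2 ?_ (fun s hs => (hu' s hs).1)
      (fun s => ?_) (fun s hs => ((hu' s hs).2.trans
        (hCW (x, s) ⟨h1, hs.1.le, hs.2.le.trans h3⟩ _ (le_max_right _ _)))) (hU0 x) (by positivity)
    · exact hU.comp (by fun_prop) fun s hs => ⟨h1, hs.1, hs.2.trans h3⟩
    · have := (((hasDerivAt_id s).sub_const x).const_mul k).exp.const_mul (W / 2)
      simpa using this
  have hVle : ∀ p ∈ D, |V p| ≤ W / 2 * Real.exp (k * (p.2 - p.1)) := by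
    rintro ⟨x, y⟩ ⟨h1, h2, h3⟩
    simp only at h1 h2 h3
    have hex : ∀ s, ∃ v', s ∈ Ioo (-y) (-x) → HasDerivAt (fun s => V (-s, y)) v' s ∧
        |v'| ≤ C * |U (-s, y)| := fun s => by
      by_cases hs : s ∈ Ioo (-y) (-x)
      · obtain ⟨v', hv, hv2⟩ := hV' (-s) y (h1.trans (by linarith [hs.2])) (by linarith [hs.1]) h3
        refine ⟨-v', fun _ => ⟨?_, by rwa [abs_neg]⟩⟩
        have := hv.comp s (hasDerivAt_neg s)
        simpa [Function.comp_def] using this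
      · exact ⟨0, fun h => absurd h hs⟩
    choose v' hv' using hex
    have := abs_le_of_abs_deriv_le (u := fun s => V (-s, y)) (u' := v')
      (B := fun s => W / 2 * Real.exp (k * (y + s)))
      (B' := fun s => W / 2 * (Real.exp (k * (y + s)) * k)) (neg_le_neg h2) ?_
      (fun s hs => (hv' s hs).1)
      (fun s => ?_) (fun s hs => ((hv' s hs).2.trans ?_)) (by simp [hV0 y]) (by positivity)
    · simpa [sub_eq_add_neg] using this
    · exact hV.comp (by fun_prop) fun s hs =>
        ⟨h1.trans (by linarith [hs.2]), by simp only; linarith [hs.1], h3⟩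
    · have := (((hasDerivAt_id s).const_add y).const_mul k).exp.const_mul (W / 2)
      simpa using this
    · have := hCW (-s, y) ⟨h1.trans (by linarith [hs.2]), by simp only; linarith [hs.1], h3⟩
        (U (-s, y)) (le_max_left _ _)
      simpa using this
  have hWle : W ≤ W / 2 := by
    have := max_le (hUle q hqD) (hVle q hqD)
    rwa [← div_le_iff₀ (Real.exp_pos _), div_eq_mul_inv, ← Real.exp_neg] at this
  have hW00 : W = 0 := by linarith
  have hfin := hmax (a, b) ⟨ha, hab, hb⟩
  rw [hW00, zero_mul, max_le_iff] at hfin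
  exact ⟨abs_nonpos_iff.1 hfin.1, abs_nonpos_iff.1 hfin.2⟩

variable {Λm Λp : ℝ → ℝ} {T : ℝ} {lm lp : ℝ → ℝ → ℝ}

/-- A `C¹` function with `∂ₜ u + c ∂ₓ u = 0` has differential `∂ₓu (dx - c dt)`. -/
lemma hasFDerivAt_of_transport {u : ℝ → ℝ → ℝ} {c t x : ℝ}
    (hu : DifferentiableAt ℝ (fun p : ℝ × ℝ => u p.1 p.2) (t, x))
    (heq : deriv (fun s => u s x) t + c * deriv (fun y => u t y) x = 0) :
    HasFDerivAt (fun p : ℝ × ℝ => u p.1 p.2)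
      (deriv (fun y => u t y) x •
        (ContinuousLinearMap.snd ℝ ℝ ℝ - c • ContinuousLinearMap.fst ℝ ℝ ℝ)) (t, x) := by
  have hL := hu.hasFDerivAt
  set L := fderiv ℝ (fun p : ℝ × ℝ => u p.1 p.2) (t, x)
  have h1 : HasDerivAt (fun s => u s x) (L (1, 0)) t :=
    hL.comp_hasDerivAt (f := fun s => (s, x)) t ((hasDerivAt_id t).prodMk (hasDerivAt_const t x))
  have h2 : HasDerivAt (fun y => u t y) (L (0, 1)) x :=
    hL.comp_hasDerivAt (f := fun y => (t, y)) x ((hasDerivAt_const x t).prodMk (hasDerivAt_id x))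
  rw [h1.deriv, h2.deriv] at heq
  rw [h2.deriv]
  convert hL using 1
  ext
  · simp; linarith
  · simp

/-- On a compact subset of the strip, `∂ₓ u` is bounded at positive times, uniformly up to
`t = 0`. -/
lemma exists_bound_deriv {u : ℝ → ℝ → ℝ}
    (hu : ContDiffOn ℝ 1 (fun p : ℝ × ℝ => u p.1 p.2) (Ico 0 T ×ˢ univ)) {K : Set (ℝ × ℝ)}
    (hK : IsCompact K) (hKT : K ⊆ Ico 0 T ×ˢ univ) :
    ∃ C, ∀ t x, (t, x) ∈ K → 0 < t → |deriv (fun y => u t y) x| ≤ C := by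
  rcases K.eq_empty_or_nonempty with rfl | ⟨p, hp⟩
  · exact ⟨0, by simp⟩
  have hT : (0 : ℝ) < T := (hKT hp).1.1.trans_lt (hKT hp).1.2
  obtain ⟨C, hC⟩ := hK.exists_bound_of_continuousOn
    ((hu.continuousOn_fderivWithin ((uniqueDiffOn_Ico 0 T).prod uniqueDiffOn_univ) le_rfl).mono hKT)
  refine ⟨C * ‖((0, 1) : ℝ × ℝ)‖, fun t x htx ht => ?_⟩
  have hn : Ico 0 T ×ˢ (univ : Set ℝ) ∈ 𝓝 (t, x) :=
    prod_mem_nhds (Ico_mem_nhds ht (hKT htx).1.2) univ_mem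
  have hL := ((hu.contDiffAt hn).differentiableAt (by norm_num)).hasFDerivAt
  have h2 : HasDerivAt (fun y => u t y) (fderiv ℝ (fun p : ℝ × ℝ => u p.1 p.2) (t, x) (0, 1)) x :=
    hL.comp_hasDerivAt (f := fun y => (t, y)) x ((hasDerivAt_const x t).prodMk (hasDerivAt_id x))
  rw [h2.deriv, ← fderivWithin_of_mem_nhds hn, ← Real.norm_eq_abs]
  exact ((fderivWithin ℝ _ _ _).le_opNorm _).trans (by gcongr; exact hC _ htx)

namespace Admissible

variable (h : Admissible Λm Λp)
include h

lemma hodT_pos {α β : ℝ} (hab : α < β) : 0 < hodT Λm Λp α β := by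
  rw [h.hodT_eq]; exact sub_pos.2 (h.strictMono_timeCoord hab)

lemma hodT_nonneg {α β : ℝ} (hab : α ≤ β) : 0 ≤ hodT Λm Λp α β := by
  rw [h.hodT_eq]; exact sub_nonneg.2 (h.strictMono_timeCoord.monotone hab)

lemma hodT_mono {α β a b : ℝ} (ha : α ≤ a) (hb : b ≤ β) :
    hodT Λm Λp a b ≤ hodT Λm Λp α β := by
  rw [h.hodT_eq, h.hodT_eq]
  exact sub_le_sub (h.strictMono_timeCoord.monotone hb) (h.strictMono_timeCoord.monotone ha)

omit h in
lemma hodograph_diag (α : ℝ) : hodograph Λm Λp (α, α) = (0, α) := by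
  simp [hodograph, hodT, hodX]

variable (hs : IsClassicalSolution Λm Λp T lm lp)
include hs

lemma hasFDerivAt_of_solution {α β : ℝ} (hab : α < β) (hT : hodT Λm Λp α β < T) :
    HasFDerivAt (fun p : ℝ × ℝ => lm p.1 p.2)
      (deriv (fun y => lm (hodT Λm Λp α β) y) (hodX Λm Λp α β) •
        (ContinuousLinearMap.snd ℝ ℝ ℝ - lp (hodT Λm Λp α β) (hodX Λm Λp α β) •
          ContinuousLinearMap.fst ℝ ℝ ℝ)) (hodograph Λm Λp (α, β)) ∧
    HasFDerivAt (fun p : ℝ × ℝ => lp p.1 p.2)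
      (deriv (fun y => lp (hodT Λm Λp α β) y) (hodX Λm Λp α β) •
        (ContinuousLinearMap.snd ℝ ℝ ℝ - lm (hodT Λm Λp α β) (hodX Λm Λp α β) •
          ContinuousLinearMap.fst ℝ ℝ ℝ)) (hodograph Λm Λp (α, β)) := by
  have h0 := h.hodT_pos hab
  have hn : Ico 0 T ×ˢ (univ : Set ℝ) ∈ 𝓝 (hodograph Λm Λp (α, β)) :=
    prod_mem_nhds (Ico_mem_nhds h0 hT) univ_mem
  exact ⟨hasFDerivAt_of_transport ((hs.contDiff_minus.contDiffAt hn).differentiableAt (by norm_num))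
      (hs.eq_minus _ ⟨h0, hT⟩ _),
    hasFDerivAt_of_transport ((hs.contDiff_plus.contDiffAt hn).differentiableAt (by norm_num))
      (hs.eq_plus _ ⟨h0, hT⟩ _)⟩

/-- Every classical solution is `(Λm α, Λp β)` in hodograph coordinates. The errors
`U = lm ∘ Π - Λm α` and `V = lp ∘ Π - Λp β` satisfy `∂_β U = - t_β ∂ₓlm V` and
`∂_α V = - t_α ∂ₓlp U`, and vanish on the diagonal, which `Π` maps to the line `t = 0`. -/
lemma solution_hodograph {α β : ℝ} (hab : α ≤ β) (hT : hodT Λm Λp α β < T) :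
    lm (hodT Λm Λp α β) (hodX Λm Λp α β) = Λm α ∧
      lp (hodT Λm Λp α β) (hodX Λm Λp α β) = Λp β := by
  set D : Set (ℝ × ℝ) := {p | α ≤ p.1 ∧ p.1 ≤ p.2 ∧ p.2 ≤ β}
  have hDc : IsCompact D := isCompact_triangle α β
  have hcont := h.contDiff_hodograph.continuous
  have hmaps : MapsTo (hodograph Λm Λp) D (Ico 0 T ×ˢ univ) := fun p hp =>
    ⟨⟨h.hodT_nonneg hp.2.1, (h.hodT_mono hp.1 hp.2.2).trans_lt hT⟩, trivial⟩
  have hKc : IsCompact (hodograph Λm Λp '' D) := hDc.image hcont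
  obtain ⟨C₁, hC₁⟩ := exists_bound_deriv hs.contDiff_minus hKc hmaps.image_subset
  obtain ⟨C₂, hC₂⟩ := exists_bound_deriv hs.contDiff_plus hKc hmaps.image_subset
  obtain ⟨C₃, hC₃⟩ := (isCompact_Icc (a := α) (b := β)).exists_bound_of_continuousOn
    h.contDiff_inv_gap.continuous.continuousOn
  have hC₃0 : 0 ≤ C₃ := (norm_nonneg _).trans (hC₃ α ⟨le_rfl, hab⟩)
  have hTab : ∀ a b, α ≤ a → b ≤ β → hodT Λm Λp a b < T := fun a b h1 h2 =>
    (h.hodT_mono h1 h2).trans_lt hT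
  have key := eq_zero_of_triangle (α := α) (β := β) (C := C₃ * max C₁ C₂)
    (fun p => lm (hodT Λm Λp p.1 p.2) (hodX Λm Λp p.1 p.2) - Λm p.1)
    (fun p => lp (hodT Λm Λp p.1 p.2) (hodX Λm Λp p.1 p.2) - Λp p.2) ?_ ?_ ?_ ?_ ?_ ?_
    le_rfl hab le_rfl
  · exact ⟨sub_eq_zero.1 key.1, sub_eq_zero.1 key.2⟩
  · exact (hs.contDiff_minus.continuousOn.comp hcont.continuousOn hmaps).sub
      (h.contDiff_minus.continuous.comp continuous_fst).continuousOn
  · exact (hs.contDiff_plus.continuousOn.comp hcont.continuousOn hmaps).sub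
      (h.contDiff_plus.continuous.comp continuous_snd).continuousOn
  · intro a b ha hlt hb
    have hF := (h.hasFDerivAt_of_solution hs hlt (hTab a b ha hb)).1
    have hd := (hF.comp_hasDerivAt b
      ((h.hasDerivAt_hodT_right a b).prodMk (h.hasDerivAt_hodX_right a b))).sub_const (Λm a)
    refine ⟨_, hd, ?_⟩
    have hb1 := hC₁ _ _ (mem_image_of_mem _ (show (a, b) ∈ D from ⟨ha, hlt.le, hb⟩))
      (h.hodT_pos hlt)
    have hb3 := hC₃ b ⟨ha.trans hlt.le, hb⟩
    rw [Real.norm_eq_abs] at hb3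
    simp only [smul_apply, sub_apply,
      ContinuousLinearMap.coe_snd', ContinuousLinearMap.coe_fst', smul_eq_mul]
    rw [show ∀ q v w g : ℝ, q * (w / g - v * (1 / g)) = -(1 / g * q * (v - w)) by intros; ring,
      abs_neg, abs_mul, abs_mul]
    gcongr
    exact hb1.trans (le_max_left _ _)
  · intro a b ha hlt hb
    have hF := (h.hasFDerivAt_of_solution hs hlt (hTab a b ha hb)).2
    have hd := (hF.comp_hasDerivAt a
      ((h.hasDerivAt_hodT_left a b).prodMk (h.hasDerivAt_hodX_left a b))).sub_const (Λp b)
    refine ⟨_, hd, ?_⟩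
    have hb1 := hC₂ _ _ (mem_image_of_mem _ (show (a, b) ∈ D from ⟨ha, hlt.le, hb⟩))
      (h.hodT_pos hlt)
    have hb3 := hC₃ a ⟨ha, hlt.le.trans hb⟩
    rw [Real.norm_eq_abs] at hb3
    simp only [smul_apply, sub_apply,
      ContinuousLinearMap.coe_snd', ContinuousLinearMap.coe_fst', smul_eq_mul]
    rw [show ∀ q v w g : ℝ, q * (-(w / g) - v * -(1 / g)) = 1 / g * q * (v - w) by intros; ring,
      abs_mul, abs_mul]
    gcongr
    exact hb1.trans (le_max_right _ _)
  · intro a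
    have := hodograph_diag (Λm := Λm) (Λp := Λp) a
    simp only [hodograph, Prod.mk.injEq] at this
    simp [this.1, this.2, hs.init_minus]
  · intro a
    have := hodograph_diag (Λm := Λm) (Λp := Λp) a
    simp only [hodograph, Prod.mk.injEq] at this
    simp [this.1, this.2, hs.init_plus]

/-- No classical solution survives a singular point: differentiating `lm (Π (α, β)) = Λm α` in
`α` gives `t_α (Λm α - Λp β) ∂ₓlm = Λm' α`, where the left side is zero at a singular point and
the right side is not. -/
lemma lifespan_le {p : ℝ × ℝ} (hp : p ∈ singularSet Λm Λp) : T ≤ hodT Λm Λp p.1 p.2 := by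
  obtain ⟨α, β⟩ := p
  by_contra! hlt
  obtain ⟨hab, heq⟩ := hp
  simp only at hab heq hlt
  have hF := (h.hasFDerivAt_of_solution hs hab hlt).1
  have hd := hF.comp_hasDerivAt α
    ((h.hasDerivAt_hodT_left α β).prodMk (h.hasDerivAt_hodX_left α β))
  have hev : ∀ᶠ a in 𝓝 α, a ≤ β ∧ hodT Λm Λp a β < T :=
    (eventually_le_nhds hab).and
      ((h.hasDerivAt_hodT_left α β).continuousAt.eventually (gt_mem_nhds hlt))
  have hd' : HasDerivAt (fun a => lm (hodT Λm Λp a β) (hodX Λm Λp a β)) (deriv Λm α) α :=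
    (h.hasDerivAt_minus α).congr_of_eventuallyEq
      (hev.mono fun a ha => (h.solution_hodograph hs ha.1 ha.2).1)
  have := hd'.unique hd
  rw [(h.solution_hodograph hs hab.le hlt).2, ← heq] at this
  refine (h.deriv_minus_neg α).ne (this.trans ?_)
  simp only [smul_apply, sub_apply,
    ContinuousLinearMap.coe_snd', ContinuousLinearMap.coe_fst', smul_eq_mul]
  ring

end Admissible
end Chaplygin

/-! ### Inverting the hodograph map before the first singular time -/

namespace Chaplygin

/-- The inverse of `timeCoord`, which is an increasing bijection of the line. -/
noncomputable def timeInv (Λm Λp : ℝ → ℝ) : ℝ → ℝ := Function.invFun (timeCoord Λm Λp)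

/-- The point `β` with `t(a, β) = t`, for `t` of either sign; `endpoint (-t) b` is the `α` with
`t(α, b) = t`. -/
noncomputable def endpoint (Λm Λp : ℝ → ℝ) (t a : ℝ) : ℝ := timeInv Λm Λp (timeCoord Λm Λp a + t)

/-- The position at time `t` on the curve `α = a`, that is `x(a, β)` with `β` determined by
`t(a, β) = t`. -/
noncomputable def frontX (Λm Λp : ℝ → ℝ) (t a : ℝ) : ℝ := hodX Λm Λp a (endpoint Λm Λp t a)

/-- The inverse of the hodograph map: the first coordinate of `hodInv (t, x)` is found by inverting
`frontX t`, the second one from the time. It is a right inverse everywhere, a two-sided one before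
the first singular time. -/
noncomputable def hodInv (Λm Λp : ℝ → ℝ) (q : ℝ × ℝ) : ℝ × ℝ :=
  (Function.invFun (frontX Λm Λp q.1) q.2,
    endpoint Λm Λp q.1 (Function.invFun (frontX Λm Λp q.1) q.2))

namespace Admissible

variable {Λm Λp : ℝ → ℝ} (h : Admissible Λm Λp)
include h

lemma timeCoord_timeInv (s : ℝ) : timeCoord Λm Λp (timeInv Λm Λp s) = s :=
  Function.rightInverse_invFun h.surjective_timeCoord s

lemma timeInv_timeCoord (s : ℝ) : timeInv Λm Λp (timeCoord Λm Λp s) = s :=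
  Function.leftInverse_invFun h.strictMono_timeCoord.injective s

lemma continuous_timeInv : Continuous (timeInv Λm Λp) := by
  let e := h.strictMono_timeCoord.orderIsoOfSurjective _ h.surjective_timeCoord
  have : timeInv Λm Λp = e.symm := funext fun s => by
    rw [OrderIso.eq_symm_apply]
    exact h.timeCoord_timeInv s
  rw [this]
  exact e.symm.continuous

lemma hasDerivAt_timeInv (s : ℝ) :
    HasDerivAt (timeInv Λm Λp) (Λp (timeInv Λm Λp s) - Λm (timeInv Λm Λp s)) s := by
  have := (h.hasDerivAt_timeCoord (timeInv Λm Λp s)).of_local_left_inverse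
    h.continuous_timeInv.continuousAt (one_div_ne_zero (h.gap_ne _))
    (Eventually.of_forall h.timeCoord_timeInv)
  simpa using this

lemma hodT_endpoint (t a : ℝ) : hodT Λm Λp a (endpoint Λm Λp t a) = t := by
  rw [h.hodT_eq, endpoint, h.timeCoord_timeInv, add_sub_cancel_left]

lemma endpoint_hodT (a b : ℝ) : endpoint Λm Λp (hodT Λm Λp a b) a = b := by
  rw [h.hodT_eq, endpoint, add_sub_cancel, h.timeInv_timeCoord]

lemma endpoint_neg_hodT (a b : ℝ) : endpoint Λm Λp (-hodT Λm Λp a b) b = a := by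
  rw [h.hodT_eq, endpoint, neg_sub, add_sub_cancel, h.timeInv_timeCoord]

lemma endpoint_endpoint_neg (t b : ℝ) : endpoint Λm Λp t (endpoint Λm Λp (-t) b) = b := by
  simp [endpoint, h.timeCoord_timeInv, h.timeInv_timeCoord]

lemma continuous_endpoint : Continuous fun q : ℝ × ℝ => endpoint Λm Λp q.1 q.2 :=
  h.continuous_timeInv.comp
    ((h.contDiff_timeCoord.continuous.comp continuous_snd).add continuous_fst)

lemma hasDerivAt_endpoint_time (t a : ℝ) :
    HasDerivAt (fun s => endpoint Λm Λp s a)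
      (Λp (endpoint Λm Λp t a) - Λm (endpoint Λm Λp t a)) t := by
  exact ((h.hasDerivAt_timeInv _).comp t
    ((hasDerivAt_id t).const_add (timeCoord Λm Λp a))).congr_deriv (mul_one _)

/-- At fixed time, `x` is a function of `a` whose derivative has the sign of `Λp β - Λm a`. -/
lemma hasDerivAt_frontX (t a : ℝ) :
    HasDerivAt (frontX Λm Λp t)
      ((Λp (endpoint Λm Λp t a) - Λm a) / (Λp a - Λm a)) a := by
  have he : HasDerivAt (endpoint Λm Λp t) _ a :=
    (h.hasDerivAt_timeInv _).comp a ((h.hasDerivAt_timeCoord a).add_const t)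
  have heq : frontX Λm Λp t = fun a => a + spaceCoord Λm Λp (endpoint Λm Λp t a)
      - spaceCoord Λm Λp a := funext fun a => h.hodX_eq _ _
  rw [heq]
  refine (((hasDerivAt_id a).add ((h.hasDerivAt_spaceCoord _).comp a he)).sub
    (h.hasDerivAt_spaceCoord a)).congr_deriv ?_
  have h1 := h.gap_ne a
  have h2 := h.gap_ne (endpoint Λm Λp t a)
  simp only [← endpoint.eq_1]
  field_simp
  ring

lemma continuous_frontX : Continuous fun q : ℝ × ℝ => frontX Λm Λp q.1 q.2 := by
  simp only [frontX, h.hodX_eq]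
  have := h.contDiff_spaceCoord.continuous
  have := h.continuous_endpoint
  fun_prop

lemma abs_spaceCoord_sub_le {M : ℝ} (hM : ∀ x, |Λp x| ≤ M) (a b : ℝ) :
    |spaceCoord Λm Λp b - spaceCoord Λm Λp a|
      ≤ M * |timeCoord Λm Λp b - timeCoord Λm Λp a| := by
  wlog hab : a ≤ b generalizing a b
  · rw [abs_sub_comm, abs_sub_comm (timeCoord _ _ _)]
    exact this b a (le_of_not_ge hab)
  have h1 : ∀ s, HasDerivAt (fun s => M * timeCoord Λm Λp s - spaceCoord Λm Λp s)
      ((M - Λp s) / (Λp s - Λm s)) s := fun s =>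
    (((h.hasDerivAt_timeCoord s).const_mul M).sub (h.hasDerivAt_spaceCoord s)).congr_deriv
      (by ring)
  have h2 : ∀ s, HasDerivAt (fun s => M * timeCoord Λm Λp s + spaceCoord Λm Λp s)
      ((M + Λp s) / (Λp s - Λm s)) s := fun s =>
    (((h.hasDerivAt_timeCoord s).const_mul M).add (h.hasDerivAt_spaceCoord s)).congr_deriv
      (by ring)
  have m1 := monotone_of_deriv_nonneg (fun s => (h1 s).differentiableAt) (fun s => by
    rw [(h1 s).deriv]
    exact div_nonneg (by linarith [(abs_le.1 (hM s)).2]) (h.gap_pos s).le) hab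
  have m2 := monotone_of_deriv_nonneg (fun s => (h2 s).differentiableAt) (fun s => by
    rw [(h2 s).deriv]
    exact div_nonneg (by linarith [(abs_le.1 (hM s)).1]) (h.gap_pos s).le) hab
  simp only at m1 m2
  rw [abs_of_nonneg (sub_nonneg.2 (h.strictMono_timeCoord.monotone hab)), abs_le]
  constructor <;> linarith

lemma surjective_frontX (t : ℝ) : Function.Surjective (frontX Λm Λp t) := by
  obtain ⟨M, -, hM⟩ := h.exists_bound
  have hb : ∀ a, |frontX Λm Λp t a - a| ≤ M * |t| := fun a => by
    have := h.abs_spaceCoord_sub_le (fun x => (hM x).2) a (endpoint Λm Λp t a)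
    rw [← h.hodT_eq, h.hodT_endpoint] at this
    rwa [frontX, h.hodX_eq, add_sub_assoc, add_sub_cancel_left]
  refine (h.continuous_frontX.comp (Continuous.prodMk_right t)).surjective ?_ ?_
  · refine tendsto_atTop_mono (fun a => ?_)
      (tendsto_atTop_add_const_right _ (-(M * |t|)) tendsto_id)
    have := (abs_le.1 (hb a)).1
    simp only [id, Function.comp]
    linarith
  · refine tendsto_atBot_mono (fun a => ?_)
      (tendsto_atBot_add_const_right _ (M * |t|) tendsto_id)
    have := (abs_le.1 (hb a)).2
    simp only [id, Function.comp]
    linarith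

lemma frontX_hodInv (q : ℝ × ℝ) : frontX Λm Λp q.1 (hodInv Λm Λp q).1 = q.2 :=
  Function.invFun_eq (h.surjective_frontX q.1 q.2)

lemma hodograph_hodInv (q : ℝ × ℝ) : hodograph Λm Λp (hodInv Λm Λp q) = q :=
  Prod.ext (h.hodT_endpoint _ _) (h.frontX_hodInv q)

lemma hodT_hodInv (q : ℝ × ℝ) :
    hodT Λm Λp (hodInv Λm Λp q).1 (hodInv Λm Λp q).2 = q.1 :=
  congrArg Prod.fst (h.hodograph_hodInv q)

lemma hodX_hodInv (q : ℝ × ℝ) :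
    hodX Λm Λp (hodInv Λm Λp q).1 (hodInv Λm Λp q).2 = q.2 :=
  congrArg Prod.snd (h.hodograph_hodInv q)

lemma le_of_hodT_nonneg {a b : ℝ} (hab : 0 ≤ hodT Λm Λp a b) : a ≤ b := by
  rwa [h.hodT_eq, sub_nonneg, h.strictMono_timeCoord.le_iff_le] at hab

lemma frontX_hodT (a b : ℝ) : frontX Λm Λp (hodT Λm Λp a b) a = hodX Λm Λp a b := by
  rw [frontX, h.endpoint_hodT]

section Earliest

variable {α₀ β₀ : ℝ} (hE : IsEarliestSingular Λm Λp α₀ β₀)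
include hE

/-- If `Λp b ≤ Λm a`, then `Λp` takes the value `Λm a` between `a` and `b`, which is a singular
point and so not earlier than `(α₀, β₀)`. -/
lemma exists_singular_le {a b : ℝ} (hab : Λp b ≤ Λm a) :
    ∃ c ≤ b, Λp c = Λm a ∧ hodT Λm Λp α₀ β₀ ≤ hodT Λm Λp a c := by
  have hlt : a < b := h.strictAnti_plus.lt_iff_gt.1 (hab.trans_lt (h.lt a))
  obtain ⟨c, hc, hca⟩ := intermediate_value_Icc' hlt.le h.contDiff_plus.continuous.continuousOn
    (show Λm a ∈ Icc (Λp b) (Λp a) from ⟨hab, (h.lt a).le⟩)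
  exact ⟨c, hc.2, hca, hE (a, c) ⟨h.lt_of_minus_eq_plus hca.symm, hca.symm⟩⟩

lemma minus_lt_plus {a b : ℝ} (hab : hodT Λm Λp a b < hodT Λm Λp α₀ β₀) : Λm a < Λp b := by
  by_contra! hle
  obtain ⟨c, hcb, -, hc⟩ := h.exists_singular_le hE hle
  exact absurd (hc.trans (h.hodT_mono le_rfl hcb)) (not_le.2 hab)

lemma minus_le_plus {a b : ℝ} (hab : hodT Λm Λp a b ≤ hodT Λm Λp α₀ β₀) : Λm a ≤ Λp b := by
  by_contra! hlt
  obtain ⟨c, hcb, hca, hc⟩ := h.exists_singular_le hE hlt.le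
  have hcb' : c < b := lt_of_le_of_ne hcb (by rintro rfl; exact hlt.ne hca)
  have := h.strictMono_timeCoord hcb'
  rw [h.hodT_eq a c] at hc
  rw [h.hodT_eq a b] at hab
  linarith

lemma strictMono_frontX {t : ℝ} (ht : t < hodT Λm Λp α₀ β₀) : StrictMono (frontX Λm Λp t) :=
  strictMono_of_deriv_pos fun a => by
    rw [(h.hasDerivAt_frontX t a).deriv]
    exact div_pos (sub_pos.2 (h.minus_lt_plus hE (by rwa [h.hodT_endpoint]))) (h.gap_pos a)

lemma hodInv_hodograph {p : ℝ × ℝ} (hp : hodT Λm Λp p.1 p.2 < hodT Λm Λp α₀ β₀) :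
    hodInv Λm Λp (hodograph Λm Λp p) = p := by
  have h1 : Function.invFun (frontX Λm Λp (hodT Λm Λp p.1 p.2)) (hodX Λm Λp p.1 p.2) = p.1 := by
    rw [← h.frontX_hodT]
    exact Function.leftInverse_invFun (h.strictMono_frontX hE hp).injective _
  refine Prod.ext h1 ?_
  simp only [hodInv, hodograph]
  rw [h1, h.endpoint_hodT]

/-- Before the first singular time the inverse is `C²`, negative times included: the derivative of
the hodograph map is injective, and by injectivity of the map `hodInv` agrees with the local
inverse. -/
lemma contDiffAt_hodInv {q : ℝ × ℝ} (hq : q.1 < hodT Λm Λp α₀ β₀) :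
    ContDiffAt ℝ 2 (hodInv Λm Λp) q := by
  set p := hodInv Λm Λp q with hp
  have hpq : hodograph Λm Λp p = q := h.hodograph_hodInv q
  have hpT : hodT Λm Λp p.1 p.2 < hodT Λm Λp α₀ β₀ := by rwa [hp, h.hodT_hodInv]
  have hpos := h.minus_lt_plus hE hpT
  have hcd : ContDiffAt ℝ 2 (hodograph Λm Λp) p := h.contDiff_hodograph.contDiffAt
  have hF := (hcd.differentiableAt (by norm_num)).hasFDerivAt
  set L := fderiv ℝ (hodograph Λm Λp) p
  have h10 : L (1, 0) = _ := (hF.comp_hasDerivAt (f := fun a => (a, p.2)) p.1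
    ((hasDerivAt_id p.1).prodMk (hasDerivAt_const p.1 p.2))).unique
    ((h.hasDerivAt_hodT_left p.1 p.2).prodMk (h.hasDerivAt_hodX_left p.1 p.2))
  have h01 : L (0, 1) = _ := (hF.comp_hasDerivAt (f := fun b => (p.1, b)) p.2
    ((hasDerivAt_const p.2 p.1).prodMk (hasDerivAt_id p.2))).unique
    ((h.hasDerivAt_hodT_right p.1 p.2).prodMk (h.hasDerivAt_hodX_right p.1 p.2))
  have hinj : Function.Injective L := by
    rw [injective_iff_map_eq_zero]
    rintro ⟨u, v⟩ huv
    have hdec : ((u, v) : ℝ × ℝ) = u • ((1, 0) : ℝ × ℝ) + v • ((0, 1) : ℝ × ℝ) := by simp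
    rw [hdec, map_add, map_smul, map_smul, h10, h01] at huv
    simp only [Prod.smul_mk, Prod.mk_add_mk, smul_eq_mul, Prod.mk_eq_zero] at huv
    obtain ⟨e1, e2⟩ := huv
    have g1 := h.gap_ne p.1
    have g2 := h.gap_ne p.2
    -- `Λp β` times the `t`-component minus the `x`-component eliminates `v`
    have hu : u = 0 := by
      have : (Λp p.2 - Λm p.1) * u = 0 := by
        have e3 : (Λp p.1 - Λm p.1) * (Λp p.2 * (u * -(1 / (Λp p.1 - Λm p.1)) +
          v * (1 / (Λp p.2 - Λm p.2))) - (u * -(Λm p.1 / (Λp p.1 - Λm p.1)) +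
          v * (Λp p.2 / (Λp p.2 - Λm p.2)))) = 0 := by rw [e1, e2]; ring
        field_simp at e3
        refine (mul_eq_zero.1 (?_ : (Λp p.2 - Λm p.1) * u * (Λp p.2 - Λm p.2) = 0)).resolve_right g2
        linear_combination -e3
      exact (mul_eq_zero.1 this).resolve_left (sub_pos.2 hpos).ne'
    have hv : v = 0 := by
      rw [hu, zero_mul, zero_add] at e1
      exact (mul_eq_zero.1 e1).resolve_right (one_div_ne_zero g2)
    rw [hu, hv]
    rfl
  let e : (ℝ × ℝ) ≃L[ℝ] (ℝ × ℝ) :=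
    (LinearEquiv.ofInjectiveEndo (L : ℝ × ℝ →ₗ[ℝ] ℝ × ℝ) hinj).toContinuousLinearEquiv
  have heL : (e : ℝ × ℝ →L[ℝ] ℝ × ℝ) = L := ContinuousLinearMap.ext fun _ => rfl
  have he : HasFDerivAt (hodograph Λm Λp) (e : ℝ × ℝ →L[ℝ] ℝ × ℝ) p := by rwa [heL]
  have hn : (2 : WithTop ℕ∞) ≠ 0 := by norm_num
  have hg := hcd.to_localInverse he hn
  have hright : ∀ᶠ y in 𝓝 (hodograph Λm Λp p),
      hodograph Λm Λp (hcd.localInverse he hn y) = y :=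
    (hcd.hasStrictFDerivAt' he hn).eventually_right_inverse
  rw [hpq] at hg hright
  refine hg.congr_of_eventuallyEq ?_
  filter_upwards [hright, continuous_fst.continuousAt.eventually (gt_mem_nhds hq)] with y hy hyT
  have hyT' : hodT Λm Λp (hcd.localInverse he hn y).1 (hcd.localInverse he hn y).2
      < hodT Λm Λp α₀ β₀ := by
    rw [show hodT Λm Λp (hcd.localInverse he hn y).1 (hcd.localInverse he hn y).2 = y.1 from
      congrArg Prod.fst hy]
    exact hyT
  rw [← h.hodInv_hodograph hE hyT', hy]

end Earliest

end Admissible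
end Chaplygin

/-! ### The solution and its blowup -/

namespace Chaplygin

/-- The component `lm` of the solution: `Λm α` at `Π(α, β)`. -/
noncomputable def solMinus (Λm Λp : ℝ → ℝ) (t x : ℝ) : ℝ := Λm (hodInv Λm Λp (t, x)).1

/-- The component `lp` of the solution: `Λp β` at `Π(α, β)`. -/
noncomputable def solPlus (Λm Λp : ℝ → ℝ) (t x : ℝ) : ℝ := Λp (hodInv Λm Λp (t, x)).2

lemma hasDerivAt_comp_curve {u : ℝ → ℝ → ℝ} {τ ξ : ℝ → ℝ} {s τ' ξ' : ℝ}
    (hu : DifferentiableAt ℝ (fun p : ℝ × ℝ => u p.1 p.2) (τ s, ξ s))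
    (hτ : HasDerivAt τ τ' s) (hξ : HasDerivAt ξ ξ' s) :
    HasDerivAt (fun r => u (τ r) (ξ r))
      (τ' * deriv (fun r => u r (ξ s)) (τ s) + ξ' * deriv (fun y => u (τ s) y) (ξ s)) s := by
  have hL := hu.hasFDerivAt
  set L := fderiv ℝ (fun p : ℝ × ℝ => u p.1 p.2) (τ s, ξ s)
  have h1 : HasDerivAt (fun r => u r (ξ s)) (L (1, 0)) (τ s) :=
    hL.comp_hasDerivAt (f := fun r => (r, ξ s)) _ ((hasDerivAt_id _).prodMk (hasDerivAt_const _ _))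
  have h2 : HasDerivAt (fun y => u (τ s) y) (L (0, 1)) (ξ s) :=
    hL.comp_hasDerivAt (f := fun y => (τ s, y)) _ ((hasDerivAt_const _ _).prodMk (hasDerivAt_id _))
  refine (hL.comp_hasDerivAt (f := fun r => (τ r, ξ r)) s (hτ.prodMk hξ)).congr_deriv ?_
  rw [h1.deriv, h2.deriv, ← smul_eq_mul, ← smul_eq_mul, ← map_smul, ← map_smul, ← map_add]
  simp

namespace Admissible

variable {Λm Λp : ℝ → ℝ} (h : Admissible Λm Λp)
include h

section Earliest

variable {α₀ β₀ : ℝ} (hE : IsEarliestSingular Λm Λp α₀ β₀)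
include hE

lemma sol_hodograph {α β : ℝ} (hT : hodT Λm Λp α β < hodT Λm Λp α₀ β₀) :
    solMinus Λm Λp (hodT Λm Λp α β) (hodX Λm Λp α β) = Λm α ∧
      solPlus Λm Λp (hodT Λm Λp α β) (hodX Λm Λp α β) = Λp β := by
  have : hodInv Λm Λp (hodT Λm Λp α β, hodX Λm Λp α β) = (α, β) :=
    h.hodInv_hodograph hE (p := (α, β)) hT
  rw [solMinus, solPlus, this]
  exact ⟨rfl, rfl⟩

lemma contDiffAt_sol {q : ℝ × ℝ} (hq : q.1 < hodT Λm Λp α₀ β₀) :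
    ContDiffAt ℝ 1 (fun p : ℝ × ℝ => solMinus Λm Λp p.1 p.2) q ∧
      ContDiffAt ℝ 1 (fun p : ℝ × ℝ => solPlus Λm Λp p.1 p.2) q := by
  have hi := h.contDiffAt_hodInv hE hq
  exact ⟨(h.contDiff_minus.contDiffAt.comp q (contDiffAt_fst.comp q hi)).of_le (by norm_num),
    (h.contDiff_plus.contDiffAt.comp q (contDiffAt_snd.comp q hi)).of_le (by norm_num)⟩

/-- The equations and the space derivatives of the solution, from differentiating
`lm (Π (α, β)) = Λm α` and `lp (Π (α, β)) = Λp β` in both variables. -/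
lemma sol_partials {α β : ℝ} (hT : hodT Λm Λp α β < hodT Λm Λp α₀ β₀) :
    (deriv (fun s => solMinus Λm Λp s (hodX Λm Λp α β)) (hodT Λm Λp α β)
      + Λp β * deriv (fun y => solMinus Λm Λp (hodT Λm Λp α β) y) (hodX Λm Λp α β) = 0 ∧
    deriv (fun s => solPlus Λm Λp s (hodX Λm Λp α β)) (hodT Λm Λp α β)
      + Λm α * deriv (fun y => solPlus Λm Λp (hodT Λm Λp α β) y) (hodX Λm Λp α β) = 0) ∧
    deriv (fun y => solMinus Λm Λp (hodT Λm Λp α β) y) (hodX Λm Λp α β)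
      = deriv Λm α * (Λp α - Λm α) / (Λp β - Λm α) ∧
    deriv (fun y => solPlus Λm Λp (hodT Λm Λp α β) y) (hodX Λm Λp α β)
      = deriv Λp β * (Λp β - Λm β) / (Λp β - Λm α) := by
  obtain ⟨hm, hp⟩ := h.contDiffAt_sol hE (q := (hodT Λm Λp α β, hodX Λm Λp α β)) hT
  have hm := hm.differentiableAt one_ne_zero
  have hp := hp.differentiableAt one_ne_zero
  have ga := h.gap_ne α
  have gb := h.gap_ne β
  have gab := (sub_pos.2 (h.minus_lt_plus hE hT)).ne'
  have hTa := h.hasDerivAt_hodT_left α β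
  have hXa := h.hasDerivAt_hodX_left α β
  have hTb := h.hasDerivAt_hodT_right α β
  have hXb := h.hasDerivAt_hodX_right α β
  have eva := hTa.continuousAt.eventually (gt_mem_nhds hT)
  have evb := hTb.continuousAt.eventually (gt_mem_nhds hT)
  have ma := (hasDerivAt_comp_curve (τ := fun a => hodT Λm Λp a β) hm hTa hXa).unique
    ((h.hasDerivAt_minus α).congr_of_eventuallyEq
      (eva.mono fun a ha => (h.sol_hodograph hE ha).1))
  have mb := (hasDerivAt_comp_curve (τ := fun b => hodT Λm Λp α b) hm hTb hXb).unique
    ((hasDerivAt_const β (Λm α)).congr_of_eventuallyEq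
      (evb.mono fun b hb => (h.sol_hodograph hE hb).1))
  have pa := (hasDerivAt_comp_curve (τ := fun a => hodT Λm Λp a β) hp hTa hXa).unique
    ((hasDerivAt_const α (Λp β)).congr_of_eventuallyEq
      (eva.mono fun a ha => (h.sol_hodograph hE ha).2))
  have pb := (hasDerivAt_comp_curve (τ := fun b => hodT Λm Λp α b) hp hTb hXb).unique
    ((h.hasDerivAt_plus β).congr_of_eventuallyEq
      (evb.mono fun b hb => (h.sol_hodograph hE hb).2))
  field_simp at ma mb pa pb
  refine ⟨⟨by linarith, by linarith⟩, ?_, ?_⟩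
  · rw [eq_div_iff gab]
    linear_combination ma + mb
  · rw [eq_div_iff gab]
    linear_combination pa + pb

variable (H3 : (α₀, β₀) ∈ singularSet Λm Λp)
include H3

lemma isClassicalSolution_sol :
    IsClassicalSolution Λm Λp (hodT Λm Λp α₀ β₀) (solMinus Λm Λp) (solPlus Λm Λp) := by
  have hpde : ∀ t < hodT Λm Λp α₀ β₀, ∀ x,
      deriv (fun s => solMinus Λm Λp s x) t
        + solPlus Λm Λp t x * deriv (fun y => solMinus Λm Λp t y) x = 0 ∧
      deriv (fun s => solPlus Λm Λp s x) t
        + solMinus Λm Λp t x * deriv (fun y => solPlus Λm Λp t y) x = 0 := fun t ht x => by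
    have hT := h.hodT_hodInv (t, x)
    have hX := h.hodX_hodInv (t, x)
    have := (h.sol_partials hE (hT.trans_lt ht)).1
    rwa [hT, hX] at this
  have hinit : ∀ x, hodInv Λm Λp (0, x) = (x, x) := fun x => by
    rw [← hodograph_diag (Λm := Λm) (Λp := Λp) x]
    refine h.hodInv_hodograph hE ?_
    simpa [hodT] using h.hodT_pos H3.1
  exact ⟨fun q hq => (h.contDiffAt_sol hE hq.1.2).1.contDiffWithinAt,
    fun q hq => (h.contDiffAt_sol hE hq.1.2).2.contDiffWithinAt,
    fun t ht x => (hpde t ht.2 x).1, fun t ht x => (hpde t ht.2 x).2,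
    fun x => by rw [solMinus, hinit], fun x => by rw [solPlus, hinit]⟩

omit hE H3 in
lemma solution_eq_sol {T : ℝ} {lm lp : ℝ → ℝ → ℝ} (hs : IsClassicalSolution Λm Λp T lm lp)
    {t : ℝ} (ht : t ∈ Ico 0 T) (x : ℝ) :
    lm t x = solMinus Λm Λp t x ∧ lp t x = solPlus Λm Λp t x := by
  have hT := h.hodT_hodInv (t, x)
  have hX := h.hodX_hodInv (t, x)
  have := h.solution_hodograph hs (h.le_of_hodT_nonneg (hT.symm ▸ ht.1)) (hT.trans_lt ht.2)
  rwa [hT, hX] at this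

lemma isLifeSpan_hodT : IsLifeSpan Λm Λp (hodT Λm Λp α₀ β₀) :=
  ⟨⟨h.hodT_pos H3.1, _, _, h.isClassicalSolution_sol hE H3⟩,
    fun _ ⟨_, _, _, hs⟩ => h.lifespan_le hs H3⟩

omit H3 in
lemma bijOn_hodograph :
    BijOn (hodograph Λm Λp) {p | p.1 ≤ p.2 ∧ hodT Λm Λp p.1 p.2 < hodT Λm Λp α₀ β₀}
      (Ico 0 (hodT Λm Λp α₀ β₀) ×ˢ univ) := by
  refine ⟨fun p hp => ⟨⟨h.hodT_nonneg hp.1, hp.2⟩, trivial⟩, fun p hp q hq hpq => ?_,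
    fun q hq => ?_⟩
  · rw [← h.hodInv_hodograph hE hp.2, hpq, h.hodInv_hodograph hE hq.2]
  · have hT := h.hodT_hodInv q
    exact ⟨hodInv Λm Λp q, ⟨h.le_of_hodT_nonneg (hT.symm ▸ hq.1.1), hT.trans_lt hq.1.2⟩,
      h.hodograph_hodInv q⟩

/-- The characteristics are the images of the lines `α = α₀` and `β = β₀`, parametrised by time. -/
lemma characteristicsTangentAt :
    CharacteristicsTangentAt (solMinus Λm Λp) (solPlus Λm Λp) α₀ β₀
      (hodT Λm Λp α₀ β₀) (hodX Λm Λp α₀ β₀) (Λm α₀) := by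
  have hm : ∀ t, HasDerivAt (fun s => hodX Λm Λp α₀ (endpoint Λm Λp s α₀))
      (Λp (endpoint Λm Λp t α₀)) t := fun t => by
    refine ((h.hasDerivAt_hodX_right α₀ _).comp t
      (h.hasDerivAt_endpoint_time t α₀)).congr_deriv ?_
    exact div_mul_cancel₀ _ (h.gap_ne _)
  have hp : ∀ t, HasDerivAt (fun s => hodX Λm Λp (endpoint Λm Λp (-s) β₀) β₀)
      (Λm (endpoint Λm Λp (-t) β₀)) t := fun t => by
    have he : HasDerivAt (fun s => endpoint Λm Λp (-s) β₀) _ t :=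
      (h.hasDerivAt_endpoint_time (-t) β₀).comp t (hasDerivAt_neg t)
    refine ((h.hasDerivAt_hodX_left _ β₀).comp t he).congr_deriv ?_
    have := h.gap_ne (endpoint Λm Λp (-t) β₀)
    field_simp
  have hpT : ∀ t, hodT Λm Λp (endpoint Λm Λp (-t) β₀) β₀ = t := fun t => by
    have := h.hodT_endpoint t (endpoint Λm Λp (-t) β₀)
    rwa [h.endpoint_endpoint_neg] at this
  refine ⟨fun s => hodX Λm Λp α₀ (endpoint Λm Λp s α₀),
    fun s => hodX Λm Λp (endpoint Λm Λp (-s) β₀) β₀, ⟨?_, fun t ht => ?_⟩, ⟨?_, fun t ht => ?_⟩,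
    fun t ht => ?_, ?_, ?_, ?_, ?_⟩
  · simp [endpoint, h.timeInv_timeCoord, hodX]
  · refine ((hm t).congr_deriv ?_).hasDerivWithinAt
    have hT := h.hodT_endpoint t α₀
    have := (h.sol_hodograph hE (hT.trans_lt ht.2)).2
    rw [hT] at this
    exact this.symm
  · simp [endpoint, h.timeInv_timeCoord, hodX]
  · refine ((hp t).congr_deriv ?_).hasDerivWithinAt
    have := (h.sol_hodograph hE ((hpT t).trans_lt ht.2)).1
    rw [hpT] at this
    exact this.symm
  · -- at time `t` both are points of the same front, which is increasing in its foot
    have hfront : frontX Λm Λp t (endpoint Λm Λp (-t) β₀)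
        = hodX Λm Λp (endpoint Λm Λp (-t) β₀) β₀ := by
      rw [frontX, h.endpoint_endpoint_neg]
    simp only [← hfront]
    refine h.strictMono_frontX hE ht.2 ?_
    rw [← h.strictMono_timeCoord.lt_iff_lt, endpoint, h.timeCoord_timeInv]
    have := ht.2
    rw [h.hodT_eq] at this
    linarith
  · simp only [h.endpoint_hodT]
  · simp only [h.endpoint_neg_hodT]
  · refine ((hm _).congr_deriv ?_).hasDerivWithinAt
    rw [h.endpoint_hodT, ← H3.2]
  · refine ((hp _).congr_deriv ?_).hasDerivWithinAt
    rw [h.endpoint_neg_hodT]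

variable (hloc : ∀ᶠ a in 𝓝[≠] α₀, hodT Λm Λp α₀ β₀ < hodT Λm Λp a (betaFun Λm Λp a))
include hloc

omit H3 in
/-- At the critical time `frontX` is still strictly increasing near `α₀`: its derivative vanishes
only at singular points of that time, and `(α₀, β₀)` is an isolated one, as a strict local minimum
of the time on the singular curve. -/
lemma exists_strictMonoOn_frontX : ∃ ε > 0,
    StrictMonoOn (frontX Λm Λp (hodT Λm Λp α₀ β₀)) (Icc (α₀ - ε) α₀) ∧
    StrictMonoOn (frontX Λm Λp (hodT Λm Λp α₀ β₀)) (Icc α₀ (α₀ + ε)) := by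
  rw [eventually_nhdsWithin_iff] at hloc
  obtain ⟨ε, hε, hball⟩ := Metric.eventually_nhds_iff_ball.1 hloc
  simp only [Real.ball_eq_Ioo] at hball
  have hpos : ∀ a ∈ Ioo (α₀ - ε) (α₀ + ε), a ≠ α₀ →
      0 < deriv (frontX Λm Λp (hodT Λm Λp α₀ β₀)) a := fun a ha hne => by
    rw [(h.hasDerivAt_frontX _ a).deriv]
    refine div_pos (sub_pos.2 (lt_of_le_of_ne
      (h.minus_le_plus hE (h.hodT_endpoint _ _).le) fun heq => ?_)) (h.gap_pos a)
    have := hball a ha hne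
    rw [h.betaFun_eq heq, h.hodT_endpoint] at this
    exact lt_irrefl _ this
  have hc : Continuous (frontX Λm Λp (hodT Λm Λp α₀ β₀)) :=
    h.continuous_frontX.comp (Continuous.prodMk_right _)
  refine ⟨ε, hε, strictMonoOn_of_deriv_pos (convex_Icc _ _) hc.continuousOn fun a ha => ?_,
    strictMonoOn_of_deriv_pos (convex_Icc _ _) hc.continuousOn fun a ha => ?_⟩
  · rw [interior_Icc] at ha
    exact hpos a ⟨ha.1, by linarith [ha.2]⟩ ha.2.ne
  · rw [interior_Icc] at ha
    exact hpos a ⟨by linarith [ha.1], ha.2⟩ ha.1.ne'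

omit H3 in
/-- The inverse hodograph map extends continuously to the image of the cusp point: the bounds
`frontX t₀ (α₀ - c) < x₀ < frontX t₀ (α₀ + c)` persist for nearby `(t, x)`, and `frontX t` is
increasing for `t < t₀`. -/
lemma tendsto_hodInv :
    Tendsto (hodInv Λm Λp)
      (𝓝[{p | p.1 < hodT Λm Λp α₀ β₀}] (hodT Λm Λp α₀ β₀, hodX Λm Λp α₀ β₀))
      (𝓝 (α₀, β₀)) := by
  obtain ⟨ε, hε, hl, hr⟩ := h.exists_strictMonoOn_frontX hE hloc
  have hx₀ := h.frontX_hodT α₀ β₀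
  have hcont : ∀ a, Continuous fun q : ℝ × ℝ => frontX Λm Λp q.1 a := fun a =>
    h.continuous_frontX.comp (continuous_fst.prodMk continuous_const)
  have hfst : Tendsto (fun q => (hodInv Λm Λp q).1)
      (𝓝[{p | p.1 < hodT Λm Λp α₀ β₀}] (hodT Λm Λp α₀ β₀, hodX Λm Λp α₀ β₀)) (𝓝 α₀) := by
    refine tendsto_order.2 ⟨fun a ha => ?_, fun a ha => ?_⟩
    · obtain ⟨c, hc1, hc2⟩ := exists_between (max_lt ha (show α₀ - ε < α₀ by linarith))
      have hlt := hl ⟨((le_max_right _ _).trans_lt hc1).le, hc2.le⟩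
        (right_mem_Icc.2 (by linarith)) hc2
      rw [hx₀] at hlt
      filter_upwards [self_mem_nhdsWithin, mem_nhdsWithin_of_mem_nhds
        ((hcont c).continuousAt.eventually_lt continuous_snd.continuousAt hlt)] with q hq hqlt
      rw [← h.frontX_hodInv q, (h.strictMono_frontX hE hq).lt_iff_lt] at hqlt
      exact ((le_max_left _ _).trans_lt hc1).trans hqlt
    · obtain ⟨c, hc1, hc2⟩ := exists_between (lt_min ha (show α₀ < α₀ + ε by linarith))
      have hlt := hr (left_mem_Icc.2 (by linarith))
        ⟨hc1.le, (hc2.trans_le (min_le_right _ _)).le⟩ hc1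
      rw [hx₀] at hlt
      filter_upwards [self_mem_nhdsWithin, mem_nhdsWithin_of_mem_nhds
        (continuous_snd.continuousAt.eventually_lt (hcont c).continuousAt hlt)] with q hq hqlt
      rw [← h.frontX_hodInv q, (h.strictMono_frontX hE hq).lt_iff_lt] at hqlt
      exact hqlt.trans (hc2.trans_le (min_le_left _ _))
  have htime : Tendsto (fun q : ℝ × ℝ => q.1)
      (𝓝[{p | p.1 < hodT Λm Λp α₀ β₀}] (hodT Λm Λp α₀ β₀, hodX Λm Λp α₀ β₀))
      (𝓝 (hodT Λm Λp α₀ β₀)) := continuous_fst.continuousAt.mono_left nhdsWithin_le_nhds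
  have hsnd := (h.continuous_endpoint.tendsto (hodT Λm Λp α₀ β₀, α₀)).comp (htime.prodMk_nhds hfst)
  rw [h.endpoint_hodT] at hsnd
  exact hfst.prodMk_nhds hsnd

/-- The space derivatives are quotients with denominator `Λp β - Λm α`, which tends to zero at the
cusp point, and numerators with nonzero limits. -/
lemma blowsUpAt : BlowsUpAt (solMinus Λm Λp) (solPlus Λm Λp)
    (hodT Λm Λp α₀ β₀) (hodX Λm Λp α₀ β₀) := by
  have hlim := h.tendsto_hodInv hE hloc
  have hα := (continuous_fst.tendsto _).comp hlim
  have hβ := (continuous_snd.tendsto _).comp hlim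
  have hm := h.contDiff_minus.continuous
  have hp := h.contDiff_plus.continuous
  have hdm := h.contDiff_minus.continuous_deriv (by norm_num)
  have hdp := h.contDiff_plus.continuous_deriv (by norm_num)
  have hden : Tendsto (fun q => Λp (hodInv Λm Λp q).2 - Λm (hodInv Λm Λp q).1)
      (𝓝[{p | p.1 < hodT Λm Λp α₀ β₀}] (hodT Λm Λp α₀ β₀, hodX Λm Λp α₀ β₀)) (𝓝[>] 0) := by
    refine tendsto_nhdsWithin_iff.2 ⟨?_, ?_⟩
    · have := ((hp.tendsto β₀).comp hβ).sub ((hm.tendsto α₀).comp hα)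
      rwa [show Λp β₀ - Λm α₀ = 0 from sub_eq_zero.2 H3.2.symm] at this
    · filter_upwards [self_mem_nhdsWithin] with q hq
      exact sub_pos.2 (h.minus_lt_plus hE ((h.hodT_hodInv q).trans_lt hq))
  have hgen : ∀ (N : ℝ × ℝ → ℝ) (D : ℝ × ℝ → ℝ), Continuous N → N (α₀, β₀) ≠ 0 →
      (∀ q : ℝ × ℝ, q.1 < hodT Λm Λp α₀ β₀ → D q = N (hodInv Λm Λp q) /
        (Λp (hodInv Λm Λp q).2 - Λm (hodInv Λm Λp q).1)) →
      Tendsto (fun q => |D q|)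
        (𝓝[{p | p.1 < hodT Λm Λp α₀ β₀}] (hodT Λm Λp α₀ β₀, hodX Λm Λp α₀ β₀)) atTop := by
    intro N D hN hN0 hD
    refine (((hN.abs.tendsto _).comp hlim).pos_mul_atTop (abs_pos.2 hN0)
      (tendsto_inv_nhdsGT_zero.comp hden)).congr' ?_
    filter_upwards [self_mem_nhdsWithin] with q hq
    have hpos := sub_pos.2 (h.minus_lt_plus hE ((h.hodT_hodInv q).trans_lt hq))
    rw [hD q hq, abs_div, abs_of_pos hpos, div_eq_mul_inv]
    rfl
  have hpart := fun (q : ℝ × ℝ) (hq : q.1 < hodT Λm Λp α₀ β₀) =>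
    (h.sol_partials hE ((h.hodT_hodInv q).trans_lt hq)).2
  simp only [h.hodT_hodInv, h.hodX_hodInv] at hpart
  obtain ⟨M, -, hM⟩ := h.exists_bound
  refine ⟨⟨M, fun t _ x => ⟨(hM _).1, (hM _).2⟩⟩, ?_, ?_⟩
  · exact hgen (fun p => deriv Λm p.1 * (Λp p.1 - Λm p.1)) _ (by fun_prop)
      (mul_ne_zero (h.deriv_minus_neg _).ne (h.gap_ne _)) fun q hq => (hpart q hq).1
  · exact hgen (fun p => deriv Λp p.2 * (Λp p.2 - Λm p.2)) _ (by fun_prop)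
      (mul_ne_zero (h.deriv_plus_neg _).ne (h.gap_ne _)) fun q hq => (hpart q hq).2

end Earliest

end Admissible
end Chaplygin

theorem theorem2p1 (Λm Λp : ℝ → ℝ)
    (hΛm : ContDiff ℝ 2 Λm) (hΛp : ContDiff ℝ 2 Λp)
    (hbdd : ∃ M : ℝ, ∀ x, |Λm x| ≤ M ∧ |Λp x| ≤ M)
    (H1 : ∀ x, Λm x < Λp x)
    (H2 : ∀ x, deriv Λm x < 0 ∧ deriv Λp x < 0)
    (α₀ β₀ : ℝ) (H3 : (α₀, β₀) ∈ Chaplygin.singularSet Λm Λp)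
    (H4 : Chaplygin.cuspFun Λm Λp α₀ = 0)
    (H5 : deriv (Chaplygin.cuspFun Λm Λp) α₀ < 0)
    (t₀ x₀ : ℝ)
    (ht₀ : t₀ = ∫ ζ in α₀..β₀, 1 / (Λp ζ - Λm ζ))
    (hx₀ : x₀ = (α₀ + β₀ + ∫ ζ in α₀..β₀, (Λp ζ + Λm ζ) / (Λp ζ - Λm ζ)) / 2) :
    -- `(α₀,β₀)` is a cusp point, and a strict local minimum of the time on the singular curve
    Chaplygin.IsCuspPoint Λm Λp α₀ β₀ ∧
    (∀ᶠ α in 𝓝[≠] α₀, t₀ < Chaplygin.hodT Λm Λp α (Chaplygin.betaFun Λm Λp α)) ∧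
    -- no classical solution lives longer than `t₀`
    (∀ T lm lp, Chaplygin.IsClassicalSolution Λm Λp T lm lp → T ≤ t₀) ∧
    -- `t₀` is the blowup time exactly when `(α₀,β₀)` is the earliest singular point,
    -- which is the case if the cusp function has no zero besides `α₀`
    (Chaplygin.IsLifeSpan Λm Λp t₀ ↔ Chaplygin.IsEarliestSingular Λm Λp α₀ β₀) ∧
    ((∀ p ∈ Chaplygin.singularSet Λm Λp, Chaplygin.cuspFun Λm Λp p.1 = 0 → p.1 = α₀) →
      Chaplygin.IsEarliestSingular Λm Λp α₀ β₀) ∧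
    -- in that case the unique classical solution blows up at `(t₀,x₀)`, geometrically
    (Chaplygin.IsEarliestSingular Λm Λp α₀ β₀ →
      ∃ lm lp : ℝ → ℝ → ℝ,
        Chaplygin.IsClassicalSolution Λm Λp t₀ lm lp ∧
        (∀ T lm' lp', Chaplygin.IsClassicalSolution Λm Λp T lm' lp' →
          ∀ t ∈ Ico 0 T, ∀ x, lm' t x = lm t x ∧ lp' t x = lp t x) ∧
        Chaplygin.BlowsUpAt lm lp t₀ x₀ ∧
        Chaplygin.IsGeometricBlowup Λm Λp lm lp α₀ β₀ t₀ x₀) := by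
  have h : Chaplygin.Admissible Λm Λp :=
    ⟨hΛm, hΛp, hbdd, H1, fun x => (H2 x).1, fun x => (H2 x).2⟩
  obtain rfl : t₀ = Chaplygin.hodT Λm Λp α₀ β₀ := ht₀
  obtain rfl : x₀ = Chaplygin.hodX Λm Λp α₀ β₀ := hx₀
  have hcusp := h.isCuspPoint H3 H4 H5
  have hloc := h.eventually_hodT_lt H3 H4 H5
  refine ⟨hcusp, hloc, fun T lm lp hs => h.lifespan_le hs H3,
    ⟨?_, fun hE => h.isLifeSpan_hodT hE H3⟩,
    h.isEarliestSingular_of_unique_zero H3 H4 H5, fun hE => ?_⟩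
  · rintro ⟨⟨-, lm, lp, hs⟩, -⟩ p hp
    exact h.lifespan_le hs hp
  · refine ⟨Chaplygin.solMinus Λm Λp, Chaplygin.solPlus Λm Λp, h.isClassicalSolution_sol hE H3,
      fun T lm' lp' hs t ht x => h.solution_eq_sol hs ht x, h.blowsUpAt hE H3 hloc, ?_⟩
    refine ⟨h.bijOn_hodograph hE, fun α β _ hT => ?_, fun α β _ hT => h.sol_hodograph hE hT, rfl,
      hcusp, h.characteristicsTangentAt hE H3⟩
    rw [h.hodJacobian_eq]
    exact div_ne_zero (sub_neg.2 (h.minus_lt_plus hE hT)).ne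
      (mul_ne_zero (h.gap_ne _) (h.gap_ne _))
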